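/- Let $U=\{(b,a): b\in\mathbb R,\ a>0\}$ be the affine group, with product $(b,a)\cdot(c,d)=(b+ac,ad)$ and left Haar measure $d\mu=\frac{db\,da}{a^2}$. Its (infinite-dimensional) irreducible unitary representations $\rho_\pm$ act on $L^2(\mathbb R_\pm)$ by $(\rho_\pm(b,a)u)(s)=a^{1/2}e^{-ibs}u(as)$, and we put $\widehat U=\{\rho_+,\rho_-\}$. Let $K_\pm$ be the Duflo–Moore operators $(K_\pm\phi)(s)=|s|\phi(s)$ on $L^2(\mathbb R_\pm)$, and let $S_p$ denote the Schatten classes, $\|T\|_{S_p}^p=\operatorname{Tr}|T|^p$. For $1\le p<\infty$ let $L^p(U\times\widehat U,S_p)$ be the set of measurable functions $\sigma$ on $U\times\widehat U$, with $\sigma(x,\rho_\pm)\in S_p(L^2(\mathbb R_\pm))$, such that $$\|\sigma\|_{p,\mu}^p=\sum_{\pm}\int_U\|\sigma(x,\rho_\pm)K_\pm^{1/p}\|_{S_p}^p\,d\mu(x)<\infty,$$ where the norm is that of the bounded extension of the densely defined operator $\sigma(x,\rho_\pm)K_\pm^{1/p}$ (and is $\infty$ if there is none). For $f,g\in C_c^\infty(U)$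 let $$W(f,g)(x,\rho_\pm)=\int_U f(y)\,g(y^{-1}x)\,\rho_\pm(y)\,d\mu(y)$$ be the Wigner transform. The Weyl transform $W_\sigma$ with symbol $\sigma$ is given by $$\langle W_\sigma f,\overline g\rangle=\langle W(f,g),\sigma\rangle_\mu=\sum_{\pm}\int_U\operatorname{Tr}\bigl(\sigma(x,\rho_\pm)^*\,W(f,g)(x,\rho_\pm)\,K_\pm\bigr)\,d\mu(x),\qquad f,g\in C_c^\infty(U).$$ **Theorem.** For every $2<p<\infty$ there is a symbol $\sigma\in L^p(U\times\widehat U,S_p)$ such that $W_\sigma$ is not a bounded linear operator on $L^2(U)$. That is, for all $f,g\in C_c^\infty(U)$ the expression $\langle W(f,g),\sigma\rangle_\mu$ is well defined (for almost every $x$ the operators $\sigma(x,\rho_\pm)^*W(f,g)(x,\rho_\pm)K_\pm$ extend to trace class operators, and their traces are $\mu$-integrable in $x$), but there is no bounded linear operator $T$ on $L^2(U)$ with $\langle Tf,\overline g\rangle=\langle W(f,g),\sigma\rangle_\mu$ for all $f,g\in C_c^\infty(U)$. -/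

import Mathlib

open MeasureTheory
open scoped ENNReal InnerProductSpace

noncomputable section

namespace AffineWeyl

/-! The affine group `U = {(b, a) : b ∈ ℝ, a > 0}` -/

/-- The points `(b, a)` of the upper half plane. -/
@[ext]
structure U where
  b : ℝ
  a : ℝ
  pos : 0 < a

/-- Coordinates on the upper half plane. -/
def U.coord (x : U) : ℝ × ℝ := (x.b, x.a)

instance : Mul U := ⟨fun x y => ⟨x.b + x.a * y.b, x.a * y.a, mul_pos x.pos y.pos⟩⟩

instance : One U := ⟨⟨0, 1, one_pos⟩⟩

instance : Inv U := ⟨fun x => ⟨-x.b / x.a, 1 / x.a, one_div_pos.mpr x.pos⟩⟩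

instance : Group U :=
  Group.ofLeftAxioms
    (fun x y z => by
      apply U.ext
      · change (x.b + x.a * y.b) + (x.a * y.a) * z.b = x.b + x.a * (y.b + y.a * z.b)
        ring
      · exact mul_assoc x.a y.a z.a)
    (fun x => by
      apply U.ext
      · change 0 + 1 * x.b = x.b
        ring
      · exact one_mul x.a)
    (fun x => by
      have hx := x.pos.ne'
      apply U.ext
      · change -x.b / x.a + 1 / x.a * x.b = 0
        field_simp
        ring
      · change 1 / x.a * x.a = 1
        field_simp)

instance : MeasurableSpace U := MeasurableSpace.comap U.coord inferInstance

/-- The left Haar measure `dμ = db da / a²` of `U`. -/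
def haar : Measure U :=
  Measure.comap U.coord
    ((volume : Measure (ℝ × ℝ)).withDensity fun z => ENNReal.ofReal (1 / z.2 ^ 2))

/-- The class `C_c^∞(U)`: restrictions to the open half plane of smooth functions on `ℝ²`
whose (compact) support lies in the open half plane. -/
def IsTest (f : U → ℂ) : Prop :=
  ∃ F : ℝ × ℝ → ℂ, ContDiff ℝ (⊤ : ℕ∞) F ∧ HasCompactSupport F ∧
    tsupport F ⊆ {z : ℝ × ℝ | 0 < z.2} ∧ ∀ x : U, f x = F x.coord

/-! The two representations; `true` stands for `ρ₊`, `false` for `ρ₋`. -/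

/-- The half lines `ℝ₊` and `ℝ₋` (the endpoint `0` is a null set). -/
def halfLine : Bool → Set ℝ
  | true => Set.Ioi 0
  | false => Set.Iio 0

/-- Lebesgue measure on a half line. -/
def leb (ε : Bool) : Measure ℝ := volume.restrict (halfLine ε)

/-- The Hilbert spaces `L²(ℝ₊)` and `L²(ℝ₋)`. -/
abbrev H (ε : Bool) : Type := Lp ℂ 2 (leb ε)

lemma map_leb (ε : Bool) {a : ℝ} (ha : 0 < a) :
    Measure.map (fun s => a * s) (leb ε) = ENNReal.ofReal a⁻¹ • leb ε := by
  have hpre : (fun s => a * s) ⁻¹' (halfLine ε) = halfLine ε := by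
    ext s
    cases ε
    · simp [halfLine, ha]
    · simp [halfLine, ha]
  have hmeas : MeasurableSet (halfLine ε) := by
    cases ε
    · exact measurableSet_Iio
    · exact measurableSet_Ioi
  have h := Measure.restrict_map (μ := (volume : Measure ℝ))
    (f := fun s => a * s) (measurable_const_mul a) hmeas
  rw [hpre] at h
  rw [leb, ← h, Real.map_volume_mul_left ha.ne', Measure.restrict_smul, abs_of_pos (inv_pos.mpr ha)]

/-- The function `s ↦ a^{1/2} e^{-ibs} u(as)`. -/
def repFun (x : U) (u : ℝ → ℂ) (s : ℝ) : ℂ :=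
  (Real.sqrt x.a : ℂ) * Complex.exp (-(Complex.I * x.b * s)) * u (x.a * s)

lemma aesm_comp (ε : Bool) (x : U) {u : ℝ → ℂ} (hu : AEStronglyMeasurable u (leb ε)) :
    AEStronglyMeasurable (fun s => u (x.a * s)) (leb ε) := by
  have h : AEStronglyMeasurable u (Measure.map (fun s => x.a * s) (leb ε)) := by
    rw [map_leb ε x.pos]
    exact hu.smul_measure _
  exact h.comp_measurable (measurable_const_mul x.a)

lemma aesm_repFun (ε : Bool) (x : U) {u : ℝ → ℂ} (hu : AEStronglyMeasurable u (leb ε)) :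
    AEStronglyMeasurable (repFun x u) (leb ε) := by
  refine AEStronglyMeasurable.mul (Continuous.aestronglyMeasurable ?_) (aesm_comp ε x hu)
  fun_prop

lemma eLpNorm_repFun (ε : Bool) (x : U) {u : ℝ → ℂ} (hu : AEStronglyMeasurable u (leb ε)) :
    eLpNorm (repFun x u) 2 (leb ε) = eLpNorm u 2 (leb ε) := by
  have hmap : AEStronglyMeasurable u (Measure.map (fun s => x.a * s) (leb ε)) := by
    rw [map_leb ε x.pos]
    exact hu.smul_measure _
  have h1 : eLpNorm (repFun x u) 2 (leb ε)
      = eLpNorm ((Real.sqrt x.a : ℂ) • fun s => u (x.a * s)) 2 (leb ε) := by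
    refine eLpNorm_congr_norm_ae (Filter.Eventually.of_forall fun s => ?_)
    have : (-(Complex.I * x.b * s)) = ((-(x.b * s) : ℝ) : ℂ) * Complex.I := by
      push_cast
      ring
    simp only [repFun, this, norm_mul, Complex.norm_exp_ofReal_mul_I, mul_one, Pi.smul_apply,
      smul_eq_mul]
  have h2 : eLpNorm (fun s => u (x.a * s)) 2 (leb ε)
      = eLpNorm u 2 (ENNReal.ofReal x.a⁻¹ • leb ε) := by
    rw [← map_leb ε x.pos]
    exact (eLpNorm_map_measure hmap (measurable_const_mul x.a).aemeasurable).symm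
  have h0 : ENNReal.ofReal x.a⁻¹ ≠ 0 := by
    simpa using x.pos
  rw [h1, eLpNorm_const_smul, h2, eLpNorm_smul_measure_of_ne_zero h0, smul_eq_mul, ← mul_assoc]
  have h3 : ‖(Real.sqrt x.a : ℂ)‖ₑ * ENNReal.ofReal x.a⁻¹ ^ (1 / (2 : ℝ≥0∞)).toReal = 1 := by
    have : ‖(Real.sqrt x.a : ℂ)‖ₑ = ENNReal.ofReal (Real.sqrt x.a) := by
      rw [← ofReal_norm, Complex.norm_real, Real.norm_of_nonneg (Real.sqrt_nonneg _)]
    rw [this, ENNReal.ofReal_rpow_of_pos (inv_pos.mpr x.pos),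
      ← ENNReal.ofReal_mul (Real.sqrt_nonneg _)]
    have h4 : (1 / (2 : ℝ≥0∞)).toReal = 1 / 2 := by simp
    rw [h4, ← Real.sqrt_eq_rpow, ← Real.sqrt_mul x.pos.le, mul_inv_cancel₀ x.pos.ne']
    simp
  rw [h3, one_mul]

lemma memLp_repFun (ε : Bool) (x : U) (u : H ε) : MemLp (repFun x u) 2 (leb ε) := by
  refine ⟨aesm_repFun ε x (Lp.aestronglyMeasurable u), ?_⟩
  rw [eLpNorm_repFun ε x (Lp.aestronglyMeasurable u)]
  exact Lp.eLpNorm_lt_top u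

lemma ae_comp (ε : Bool) (x : U) {P : ℝ → Prop} (h : ∀ᵐ s ∂(leb ε), P s) :
    ∀ᵐ s ∂(leb ε), P (x.a * s) := by
  have : ∀ᵐ s ∂(Measure.map (fun s => x.a * s) (leb ε)), P s := by
    rw [map_leb ε x.pos]
    exact Measure.ae_smul_measure h _
  exact ae_of_ae_map (measurable_const_mul x.a).aemeasurable this

/-- The unitary representation `(ρ_±(b,a)u)(s) = a^{1/2} e^{-ibs} u(as)` on `L²(ℝ_±)`. -/
def rep (ε : Bool) (x : U) : H ε →ₗᵢ[ℂ] H ε where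
  toFun u := (memLp_repFun ε x u).toLp _
  map_add' u v := by
    rw [← MemLp.toLp_add]
    refine MemLp.toLp_congr _ _ ?_
    filter_upwards [ae_comp ε x (Lp.coeFn_add u v)] with s hs
    simp only [repFun, Pi.add_apply] at hs ⊢
    rw [hs]
    ring
  map_smul' c u := by
    rw [RingHom.id_apply, ← MemLp.toLp_const_smul]
    refine MemLp.toLp_congr _ _ ?_
    filter_upwards [ae_comp ε x (Lp.coeFn_smul c u)] with s hs
    simp only [repFun, Pi.smul_apply, smul_eq_mul] at hs ⊢
    rw [hs]
    ring
  norm_map' u := by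
    change ‖(memLp_repFun ε x u).toLp _‖ = ‖u‖
    rw [Lp.norm_toLp, eLpNorm_repFun ε x (Lp.aestronglyMeasurable u), Lp.norm_def]

/-- The power `K_±^r` of the Duflo–Moore operator `(K_± φ)(s) = |s| φ(s)`, with its maximal
domain in `L²(ℝ_±)`. -/
def dufloMoore (ε : Bool) (r : ℝ) : H ε →ₗ.[ℂ] H ε where
  domain :=
    { carrier := {φ | MemLp (fun s => ((|s| ^ r : ℝ) : ℂ) * φ s) 2 (leb ε)}
      add_mem' := by
        intro φ ψ hφ hψ
        refine (memLp_congr_ae ?_).mpr (MemLp.add hφ hψ)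
        filter_upwards [Lp.coeFn_add φ ψ] with s hs
        simp only [Pi.add_apply] at hs ⊢
        rw [hs]
        ring
      zero_mem' := by
        refine (memLp_congr_ae ?_).mpr (MemLp.zero' (p := 2) (μ := leb ε) (ε := ℂ))
        filter_upwards [Lp.coeFn_zero ℂ 2 (leb ε)] with s hs
        rw [hs]
        simp
      smul_mem' := by
        intro c φ hφ
        refine (memLp_congr_ae ?_).mpr (MemLp.const_smul hφ c)
        filter_upwards [Lp.coeFn_smul c φ] with s hs
        simp only [Pi.smul_apply, smul_eq_mul] at hs ⊢
        rw [hs]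
        ring }
  toFun :=
    { toFun := fun φ => MemLp.toLp _ φ.2
      map_add' := by
        intro φ ψ
        rw [← MemLp.toLp_add]
        refine MemLp.toLp_congr _ _ ?_
        filter_upwards [Lp.coeFn_add (φ : H ε) ψ] with s hs
        simp only [Submodule.coe_add, Pi.add_apply] at hs ⊢
        rw [hs]
        ring
      map_smul' := by
        intro c φ
        rw [RingHom.id_apply, ← MemLp.toLp_const_smul]
        refine MemLp.toLp_congr _ _ ?_
        filter_upwards [Lp.coeFn_smul c (φ : H ε)] with s hs
        simp only [Submodule.coe_smul, Pi.smul_apply, smul_eq_mul] at hs ⊢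
        rw [hs]
        ring }

/-- `T` is the bounded extension to all of `L²(ℝ_±)` of the densely defined operator
`A K_±^r` (it is unique, since the domain of `K_±^r` is dense). -/
def ExtendsMulK {ε : Bool} (A : H ε → H ε) (r : ℝ) (T : H ε →L[ℂ] H ε) : Prop :=
  ∀ φ : (dufloMoore ε r).domain, T (φ : H ε) = A (dufloMoore ε r φ)

/-! Traces and Schatten classes -/

section Schatten

variable (E : Type) [NormedAddCommGroup E] [InnerProductSpace ℂ E] [CompleteSpace E]

/-- The index set of a chosen orthonormal basis. -/
def basisIndex : Set E := (exists_hilbertBasis ℂ E).choose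

/-- A chosen orthonormal basis; traces of positive or trace class operators do not depend
on the choice. -/
def onb : HilbertBasis (basisIndex E) ℂ E := (exists_hilbertBasis ℂ E).choose_spec.choose

variable {E}

/-- `‖T‖_{S_p}^p = Tr |T|^p`, as an extended nonnegative number. -/
def schattenPow (p : ℝ) (T : E →L[ℂ] E) : ℝ≥0∞ :=
  ∑' i, ENNReal.ofReal (RCLike.re ⟪onb E i, ((CFC.abs T) ^ p : E →L[ℂ] E) (onb E i)⟫_ℂ)

/-- The trace `∑ᵢ ⟨T eᵢ, eᵢ⟩` (meaningful for trace class operators). -/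
def trace (T : E →L[ℂ] E) : ℂ := ∑' i, ⟪onb E i, T (onb E i)⟫_ℂ

end Schatten

/-- `‖A K_±^r‖_{S_p}^p`, equal to `∞` if `A K_±^r` has no bounded extension. -/
def schattenPowMulK {ε : Bool} (p : ℝ) (A : H ε → H ε) (r : ℝ) : ℝ≥0∞ :=
  ⨅ (T : H ε →L[ℂ] H ε) (_ : ExtendsMulK A r T), schattenPow p T

/-- `A K_±` extends to a trace class operator. -/
def TraceClassMulK {ε : Bool} (A : H ε → H ε) : Prop :=
  ∃ T : H ε →L[ℂ] H ε, ExtendsMulK A 1 T ∧ schattenPow 1 T < ∞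

open Classical in
/-- `Tr (A K_±)`, the trace of the bounded extension of `A K_±` (and `0` if there is none). -/
def traceMulK {ε : Bool} (A : H ε → H ε) : ℂ :=
  if h : ∃ T : H ε →L[ℂ] H ε, ExtendsMulK A 1 T then trace h.choose else 0

/-! Symbols, the Wigner transform and the Weyl transform -/

/-- Operator-valued symbols on `U × Û`, where `Û = {ρ₊, ρ₋}`. -/
abbrev Symbol : Type := U → (ε : Bool) → (H ε →L[ℂ] H ε)

/-- Membership in `L^p(U × Û, S_p)`: (weakly) measurable `S_p`-valued functions with
`∑_± ∫_U ‖σ(x, ρ_±) K_±^{1/p}‖_{S_p}^p dμ(x) < ∞`. -/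
structure MemLpSchatten (p : ℝ) (σ : Symbol) : Prop where
  measurable : ∀ (ε : Bool) (φ ψ : H ε), AEStronglyMeasurable (fun x => ⟪ψ, σ x ε φ⟫_ℂ) haar
  mem_schatten : ∀ (x : U) (ε : Bool), schattenPow p (σ x ε) < ∞
  norm_lt_top : ∑ ε : Bool, ∫⁻ x, schattenPowMulK p (σ x ε) (1 / p) ∂haar < ∞

/-- The Wigner transform `W(f,g)(x, ρ_±) = ∫_U f(y) g(y⁻¹x) ρ_±(y) dμ(y)`, as an operator on
`L²(ℝ_±)`. -/
def wigner (f g : U → ℂ) (x : U) (ε : Bool) (φ : H ε) : H ε :=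
  ∫ y, (f y * g (y⁻¹ * x)) • rep ε y φ ∂haar

/-- The operator `σ(x, ρ_±)* W(f,g)(x, ρ_±)`. -/
def symbolWigner (σ : Symbol) (f g : U → ℂ) (x : U) (ε : Bool) (φ : H ε) : H ε :=
  ContinuousLinearMap.adjoint (σ x ε) (wigner f g x ε φ)

/-- `⟨W(f,g), σ⟩_μ = ∑_± ∫_U Tr(σ(x,ρ_±)* W(f,g)(x,ρ_±) K_±) dμ(x)`. -/
def weylForm (σ : Symbol) (f g : U → ℂ) : ℂ :=
  ∑ ε : Bool, ∫ x, traceMulK (symbolWigner σ f g x ε) ∂haar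

/-- The traces and the integrals in `weylForm σ f g` exist (absolutely). -/
def WeylFormExists (σ : Symbol) (f g : U → ℂ) : Prop :=
  ∀ ε : Bool, (∀ᵐ x ∂haar, TraceClassMulK (symbolWigner σ f g x ε)) ∧
    Integrable (fun x => traceMulK (symbolWigner σ f g x ε)) haar

/-- The bounded operator `T` on `L²(U)` is the Weyl transform `W_σ`:
`⟨T f, ḡ⟩ = ⟨W(f,g), σ⟩_μ` for all `f, g ∈ C_c^∞(U)`. -/
def IsWeylTransform (σ : Symbol) (T : Lp ℂ 2 haar →L[ℂ] Lp ℂ 2 haar) : Prop :=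
  ∀ f g : U → ℂ, IsTest f → IsTest g → ∀ F : Lp ℂ 2 haar, F =ᵐ[haar] f →
    ∫ x, T F x * g x ∂haar = weylForm σ f g

end AffineWeyl

end

/-! The counterexample is a rank one symbol `σ(x, ρ_±) = h(x) ⟨u, ·⟩ u`, where `u` is the indicator
of `{1 ≤ |s| ≤ 4}` and `h(b, a) = (1 + |b|)^{-t} 1_{1/2 ≤ a ≤ 2}` with `1/p < t < 1/2`. All Schatten
norms of a rank one operator agree, and `u` lies in the domain of every nonnegative power of `K`, so
membership of `σ` in `L^p` reduces to `h ∈ L^p(μ)`, that is, to `tp > 1`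
(`memLpSchatten_rankOneSymbol`, `lintegral_decay_lt_top`).

For such a symbol the Weyl form is explicit. The relation `ρ(y) K = a_y K ρ(y)` moves the unbounded
`K` from the argument onto `u`. So `σ* W(f,g) K` extends to a rank one operator, whose trace is an
inner product (`extendsMulK_symbolWigner`, `traceMulK_symbolWigner`). Substituting `x = yz` then
gives, for each sign, `∫∫ h(yz) a_y f(y) g(z) ⟨K u, ρ(y) u⟩ dμ(y) dμ(z)` (`integral_traceMulK`).

Let `f` be a bump near the identity, where `Re ⟨K u, ρ(y) u⟩ > 0` (`re_windowCoeff_pos`), and let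
`g_n` be the same bump stretched by `n` in the `b`-direction. On the supports `h(yz) ≥ (1 +
n)^{-t}`, while `∫ g_n` is proportional to `n`. Hence the form is at least a constant times
`n^{1-t}` (`le_re_weylForm`). A bounded Weyl transform would bound it by a constant times `‖g_n‖_2`,
which is of order `n^{1/2}` (`norm_weylForm_le`). As `t < 1/2`, this fails for large `n`. -/

noncomputable section

namespace AffineWeyl

/-! Schatten norms and traces of rank one operators -/

section RankOne

open InnerProductSpace
open scoped NNReal

variable {E : Type} [NormedAddCommGroup E] [InnerProductSpace ℂ E] [CompleteSpace E]

/-- The quadratic relation confines the spectrum to `{0, t}`, where the functions `x ^ p` and `t ^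
(p - 1) * x` coincide; the functional calculus does the rest. -/
lemma rpow_of_mul_self_eq_smul {A : E →L[ℂ] E} (hA : 0 ≤ A) {t p : ℝ} (ht : 0 ≤ t) (hp : 1 ≤ p)
    (h : A * A = t • A) : A ^ p = t ^ (p - 1) • A := by
  have hsa : IsSelfAdjoint A := IsSelfAdjoint.of_nonneg hA
  have hspec : ∀ x ∈ spectrum ℝ A, x * x = t * x := by
    have h1 : cfc (fun x : ℝ => x * x) A = cfc (fun x : ℝ => t * x) A := by
      rw [cfc_mul (fun x : ℝ => x) (fun x : ℝ => x) A, cfc_const_mul t (fun x : ℝ => x) A,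
        cfc_id' ℝ A, h]
    exact (cfc_eq_cfc_iff_eqOn (R := ℝ) (a := A) (f := fun x : ℝ => x * x)
      (g := fun x : ℝ => t * x)).mp h1
  have hnn : ∀ x ∈ spectrum ℝ A, 0 ≤ x := fun x hx => spectrum_nonneg_of_nonneg hA hx
  rw [CFC.rpow_eq_cfc_real hA]
  have h2 : cfc (fun x : ℝ => x ^ p) A = cfc (fun x : ℝ => t ^ (p - 1) * x) A := by
    refine cfc_congr fun x hx => ?_
    rcases (hnn x hx).eq_or_lt with h0 | h0
    · simp [← h0, Real.zero_rpow (by linarith : p ≠ 0)]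
    · have : x = t := mul_right_cancel₀ h0.ne' (hspec x hx)
      subst this
      change x ^ p = x ^ (p - 1) * x
      rw [Real.rpow_sub_one h0.ne', div_mul_cancel₀ _ h0.ne']
  rw [h2, cfc_const_mul _ (fun x : ℝ => x) A, cfc_id' ℝ A]

/-- With `T = ⟨w, ·⟩ u` one has `T* T = ‖u‖² ⟨w, ·⟩ w`, and the right-hand side is a positive square
root of it. For `w = 0` both sides vanish, whatever the quotient by zero means. -/
lemma abs_rankOne (u w : E) :
    CFC.abs (rankOne ℂ u w) = (‖u‖ / ‖w‖) • rankOne ℂ w w := by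
  have hpos : (0 : E →L[ℂ] E) ≤ (‖u‖ / ‖w‖) • rankOne ℂ w w := by
    refine smul_nonneg (by positivity) ?_
    rw [ContinuousLinearMap.nonneg_iff_isPositive]
    exact isPositive_rankOne_self w
  refine CFC.sqrt_unique ?_ hpos
  ext φ
  by_cases hw : w = 0
  · simp [hw]
  have hw' : (‖w‖ : ℂ) ≠ 0 := by simpa using hw
  simp only [ContinuousLinearMap.star_eq_adjoint, adjoint_rankOne, ContinuousLinearMap.mul_def, ContinuousLinearMap.comp_apply,
    _root_.smul_apply, rankOne_apply, inner_self_eq_norm_sq_to_K,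
    map_smul, ← Complex.coe_smul, smul_smul]
  congr 1
  push_cast
  simp only [Complex.coe_algebraMap]
  field_simp

lemma tsum_inner_rankOne (b : ℝ) (hb : 0 ≤ b) (w : E) :
    ∑' i, ENNReal.ofReal (RCLike.re ⟪onb E i, (b • rankOne ℂ w w) (onb E i)⟫_ℂ)
      = ENNReal.ofReal (b * ‖w‖ ^ 2) := by
  have key : ∀ i, RCLike.re ⟪onb E i, (b • rankOne ℂ w w) (onb E i)⟫_ℂ
      = b * ‖⟪onb E i, w⟫_ℂ‖ ^ 2 := by
    intro i
    rw [_root_.smul_apply, rankOne_apply, ← Complex.coe_smul, inner_smul_right,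
      inner_smul_right, ← inner_conj_symm w, RCLike.conj_mul]
    simp [← Complex.ofReal_pow]
  have hs : HasSum (fun i => b * ‖⟪onb E i, w⟫_ℂ‖ ^ 2) (b * ‖w‖ ^ 2) := by
    refine HasSum.mul_left b ?_
    have h := ((onb E).hasSum_inner_mul_inner w w).mapL RCLike.reCLM
    have e : ∀ i, RCLike.reCLM (⟪w, onb E i⟫_ℂ * ⟪onb E i, w⟫_ℂ) = ‖⟪onb E i, w⟫_ℂ‖ ^ 2 := by
      intro i
      rw [← inner_conj_symm w, RCLike.conj_mul]
      simp [← Complex.ofReal_pow]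
    have e' : RCLike.reCLM ⟪w, w⟫_ℂ = ‖w‖ ^ 2 := by
      rw [inner_self_eq_norm_sq_to_K]
      simp [← Complex.ofReal_pow]
    simpa only [e, e'] using h
  simp_rw [key]
  rw [← ENNReal.ofReal_tsum_of_nonneg (fun i => by positivity) hs.summable, hs.tsum_eq]

/-- For `w ≠ 0` the absolute value is `‖u‖ ‖w‖` times the projection onto the line of `w`. This is
the relation that `rpow_of_mul_self_eq_smul` needs. -/
lemma abs_rankOne_mul_self (u w : E) :
    CFC.abs (rankOne ℂ u w) * CFC.abs (rankOne ℂ u w)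
      = (‖u‖ * ‖w‖) • CFC.abs (rankOne ℂ u w) := by
  rw [abs_rankOne]
  ext φ
  by_cases hw : w = 0
  · simp [hw]
  have hw' : (‖w‖ : ℂ) ≠ 0 := by simpa using hw
  simp only [ContinuousLinearMap.mul_def, ContinuousLinearMap.comp_apply, _root_.smul_apply, rankOne_apply,
    inner_smul_right, inner_self_eq_norm_sq_to_K, ← Complex.coe_smul, smul_smul]
  congr 1
  push_cast
  simp only [Complex.coe_algebraMap]
  field_simp

lemma abs_rankOne_rpow {p : ℝ} (hp : 1 ≤ p) (u w : E) :
    (CFC.abs (rankOne ℂ u w)) ^ p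
      = ((‖u‖ * ‖w‖) ^ (p - 1) * (‖u‖ / ‖w‖)) • rankOne ℂ w w := by
  have h := rpow_of_mul_self_eq_smul (CFC.abs_nonneg (rankOne ℂ u w)) (t := ‖u‖ * ‖w‖)
    (by positivity) hp (abs_rankOne_mul_self u w)
  rw [h, abs_rankOne, smul_smul]

/-- The Schatten norm of a rank one operator does not depend on the exponent. -/
lemma schattenPow_rankOne {p : ℝ} (hp : 1 ≤ p) (u w : E) :
    schattenPow p (rankOne ℂ u w) = ENNReal.ofReal ((‖u‖ * ‖w‖) ^ p) := by
  simp only [schattenPow]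
  rw [abs_rankOne_rpow hp, tsum_inner_rankOne _ (by positivity)]
  congr 1
  by_cases h0 : ‖u‖ * ‖w‖ = 0
  · rw [h0, Real.zero_rpow (by linarith : p ≠ 0)]
    rcases mul_eq_zero.mp h0 with h | h <;> simp [h]
  · have hw : ‖w‖ ≠ 0 := right_ne_zero_of_mul h0
    rw [Real.rpow_sub_one h0]
    have hu : ‖u‖ ≠ 0 := left_ne_zero_of_mul h0
    field_simp

lemma trace_rankOne (u w : E) : trace (rankOne ℂ u w) = ⟪w, u⟫_ℂ := by
  rw [← (onb E).tsum_inner_mul_inner w u]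
  simp only [trace, rankOne_apply, inner_smul_right]

end RankOne

/-! Haar measure of the affine group -/

@[simp] lemma U.mul_b (x y : U) : (x * y).b = x.b + x.a * y.b := rfl

@[simp] lemma U.mul_a (x y : U) : (x * y).a = x.a * y.a := rfl

@[simp] lemma U.inv_b (x : U) : (x⁻¹).b = -x.b / x.a := rfl

@[simp] lemma U.inv_a (x : U) : (x⁻¹).a = 1 / x.a := rfl

lemma U.coord_injective : Function.Injective U.coord := fun x y h => by
  have := congrArg Prod.fst h
  have := congrArg Prod.snd h
  apply U.ext <;> assumption

lemma U.range_coord : Set.range U.coord = {z : ℝ × ℝ | 0 < z.2} := by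
  ext z
  constructor
  · rintro ⟨x, rfl⟩
    exact x.pos
  · intro hz
    exact ⟨⟨z.1, z.2, hz⟩, rfl⟩

lemma U.measurable_coord : Measurable U.coord := comap_measurable _

lemma measurableSet_upperHalf : MeasurableSet {z : ℝ × ℝ | 0 < z.2} :=
  measurableSet_lt measurable_const measurable_snd

lemma U.measurableEmbedding_coord : MeasurableEmbedding U.coord where
  injective := U.coord_injective
  measurable := U.measurable_coord
  measurableSet_image' := by
    rintro _ ⟨t, ht, rfl⟩
    rw [Set.image_preimage_eq_inter_range, U.range_coord]
    exact ht.inter measurableSet_upperHalf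

@[fun_prop]
lemma U.measurable_a : Measurable U.a := measurable_snd.comp U.measurable_coord

@[fun_prop]
lemma U.measurable_b : Measurable U.b := measurable_fst.comp U.measurable_coord

lemma U.measurable_of_coords {α : Type*} [MeasurableSpace α] {f : α → U}
    (hb : Measurable fun x => (f x).b) (ha : Measurable fun x => (f x).a) : Measurable f :=
  measurable_comap_iff.mpr (hb.prodMk ha)

instance : MeasurableMul₂ U where
  measurable_mul := U.measurable_of_coords (by simp only [U.mul_b]; fun_prop)
    (by simp only [U.mul_a]; fun_prop)

instance : MeasurableInv U where
  measurable_inv := U.measurable_of_coords (by simp only [U.inv_b]; fun_prop)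
    (by simp only [U.inv_a]; fun_prop)

lemma map_coord_haar : Measure.map U.coord haar
    = ((volume : Measure (ℝ × ℝ)).withDensity fun z => ENNReal.ofReal (1 / z.2 ^ 2)).restrict
      {z : ℝ × ℝ | 0 < z.2} := by
  rw [haar, U.measurableEmbedding_coord.map_comap, U.range_coord]

lemma measurable_density : Measurable fun z : ℝ × ℝ => ENNReal.ofReal (1 / z.2 ^ 2) := by
  fun_prop

instance : SigmaFinite haar := by
  have : SigmaFinite ((volume : Measure (ℝ × ℝ)).withDensity
      fun z => ENNReal.ofReal (1 / z.2 ^ 2)) :=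
    SigmaFinite.withDensity_of_ne_top (Filter.Eventually.of_forall fun _ => ENNReal.ofReal_ne_top)
  refine SigmaFinite.of_map haar U.measurable_coord.aemeasurable ?_
  rw [map_coord_haar]
  infer_instance

lemma lintegral_haar {F : ℝ × ℝ → ℝ≥0∞} (hF : Measurable F) :
    ∫⁻ x, F x.coord ∂haar
      = ∫⁻ z, ENNReal.ofReal (1 / z.2 ^ 2) * (Set.indicator {z : ℝ × ℝ | 0 < z.2} F z) := by
  rw [← U.measurableEmbedding_coord.lintegral_map, map_coord_haar,
    restrict_withDensity measurableSet_upperHalf,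
    lintegral_withDensity_eq_lintegral_mul _ measurable_density hF,
    ← lintegral_indicator measurableSet_upperHalf]
  refine lintegral_congr fun z => ?_
  by_cases hz : z ∈ {z : ℝ × ℝ | 0 < z.2}
  · simp [Set.indicator_of_mem hz]
  · simp [Set.indicator_of_notMem hz]

/-- The map `(b, a) ↦ (β + α b, δ a)` of the half plane. -/
def U.stretch (β α δ : ℝ) (hδ : 0 < δ) (x : U) : U := ⟨β + α * x.b, δ * x.a, mul_pos hδ x.pos⟩

lemma U.measurable_stretch (β α δ : ℝ) (hδ : 0 < δ) : Measurable (U.stretch β α δ hδ) :=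
  U.measurable_of_coords (by simp only [U.stretch]; fun_prop) (by simp only [U.stretch]; fun_prop)

lemma map_stretch_volume (β : ℝ) {α δ : ℝ} (hα : 0 < α) (hδ : 0 < δ) :
    Measure.map (fun z : ℝ × ℝ => (β + α * z.1, δ * z.2)) volume
      = ENNReal.ofReal (α⁻¹ * δ⁻¹) • (volume : Measure (ℝ × ℝ)) := by
  have h1 : Measure.map (fun t : ℝ => β + α * t) volume = ENNReal.ofReal α⁻¹ • volume := by
    have : (fun t : ℝ => β + α * t) = (fun t => β + t) ∘ fun t => α * t := rfl
    rw [this, ← Measure.map_map (by fun_prop) (by fun_prop), Real.map_volume_mul_left hα.ne',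
      Measure.map_smul, map_add_left_eq_self, abs_of_pos (inv_pos.mpr hα)]
  have h2 : Measure.map (fun t : ℝ => δ * t) volume = ENNReal.ofReal δ⁻¹ • volume := by
    rw [Real.map_volume_mul_left hδ.ne', abs_of_pos (inv_pos.mpr hδ)]
  have : (fun z : ℝ × ℝ => (β + α * z.1, δ * z.2))
      = Prod.map (fun t : ℝ => β + α * t) fun t : ℝ => δ * t := rfl
  rw [Measure.volume_eq_prod, this, ← Measure.map_prod_map _ _ (by fun_prop) (by fun_prop), h1, h2,
    Measure.prod_smul_left, Measure.prod_smul_right, smul_smul,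
    ← ENNReal.ofReal_mul (inv_pos.mpr hα).le]

/-- Lebesgue measure contributes `1 / (α δ)` and the density `1 / a²` contributes `δ²`. The case `α
= δ` is left invariance; the case `δ = 1` gives the scaling of the widened bumps. -/
lemma map_stretch_haar (β : ℝ) {α δ : ℝ} (hα : 0 < α) (hδ : 0 < δ) :
    Measure.map (U.stretch β α δ hδ) haar = ENNReal.ofReal (δ / α) • haar := by
  refine Measure.ext fun s hs => ?_
  obtain ⟨t, ht, rfl⟩ := hs
  have hF : Measurable (t.indicator (1 : ℝ × ℝ → ℝ≥0∞)) := measurable_one.indicator ht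
  have e1 : haar (U.coord ⁻¹' t) = ∫⁻ x, t.indicator 1 x.coord ∂haar := by
    rw [← lintegral_indicator_one (U.measurable_coord ht)]
    rfl
  have e2 : haar (U.stretch β α δ hδ ⁻¹' (U.coord ⁻¹' t))
      = ∫⁻ x, (fun z : ℝ × ℝ => t.indicator 1 (β + α * z.1, δ * z.2)) x.coord ∂haar := by
    rw [← lintegral_indicator_one (U.measurable_stretch β α δ hδ (U.measurable_coord ht))]
    rfl
  rw [Measure.map_apply (U.measurable_stretch β α δ hδ) (U.measurable_coord ht), e2,
    Measure.smul_apply, e1, lintegral_haar hF, 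
    lintegral_haar (F := fun z : ℝ × ℝ => t.indicator 1 (β + α * z.1, δ * z.2))
      (hF.comp (by fun_prop))]
  set G : ℝ × ℝ → ℝ≥0∞ := fun z => ENNReal.ofReal (1 / z.2 ^ 2) *
    Set.indicator {z : ℝ × ℝ | 0 < z.2} (t.indicator 1) z with hG
  have hGm : Measurable G := measurable_density.mul (hF.indicator measurableSet_upperHalf)
  have hGs : Measurable fun z : ℝ × ℝ => G (β + α * z.1, δ * z.2) :=
    hGm.comp (g := G) (f := fun z : ℝ × ℝ => (β + α * z.1, δ * z.2)) (by fun_prop)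
  have key : ∀ z : ℝ × ℝ, ENNReal.ofReal (1 / z.2 ^ 2) * Set.indicator {z : ℝ × ℝ | 0 < z.2}
      (fun z : ℝ × ℝ => t.indicator 1 (β + α * z.1, δ * z.2)) z
      = ENNReal.ofReal (δ ^ 2) * G (β + α * z.1, δ * z.2) := by
    intro z
    by_cases hz : 0 < z.2
    · have hz' : 0 < δ * z.2 := mul_pos hδ hz
      rw [hG]
      simp only
      rw [Set.indicator_of_mem (show z ∈ {z : ℝ × ℝ | 0 < z.2} from hz),
        Set.indicator_of_mem (show (β + α * z.1, δ * z.2) ∈ {z : ℝ × ℝ | 0 < z.2} from hz'),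
        ← mul_assoc, ← ENNReal.ofReal_mul (by positivity)]
      congr 2
      field_simp
    · have hz' : ¬ 0 < δ * z.2 := fun h => hz (pos_of_mul_pos_right h hδ.le)
      rw [hG]
      simp only
      rw [Set.indicator_of_notMem (show z ∉ {z : ℝ × ℝ | 0 < z.2} from hz),
        Set.indicator_of_notMem (show (β + α * z.1, δ * z.2) ∉ {z : ℝ × ℝ | 0 < z.2} from hz')]
      simp
  rw [lintegral_congr key, lintegral_const_mul _ hGs,
    ← lintegral_map (f := G) (g := fun z : ℝ × ℝ => (β + α * z.1, δ * z.2)) hGm (by fun_prop),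
    map_stretch_volume β hα hδ, lintegral_smul_measure, smul_eq_mul, smul_eq_mul, ← mul_assoc,
    ← ENNReal.ofReal_mul (by positivity)]
  congr 2
  field_simp

instance : haar.IsMulLeftInvariant where
  map_mul_left_eq_self g := by
    have : (fun x => g * x) = U.stretch g.b g.a g.a g.pos := rfl
    rw [this, map_stretch_haar _ g.pos g.pos, div_self g.pos.ne', ENNReal.ofReal_one, one_smul]

/-! Test functions -/

/-- On a compact subset of the open half plane `a` has a positive minimum, so the density `1 / a²`
is bounded there. -/
lemma haar_preimage_lt_top {K : Set (ℝ × ℝ)} (hK : IsCompact K)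
    (hpos : K ⊆ {z : ℝ × ℝ | 0 < z.2}) : haar (U.coord ⁻¹' K) < ∞ := by
  rcases K.eq_empty_or_nonempty with rfl | hne
  · simp
  obtain ⟨z₀, hz₀, hmin⟩ := hK.exists_isMinOn hne continuous_snd.continuousOn
  have hz₀' : 0 < z₀.2 := hpos hz₀
  have e1 : haar (U.coord ⁻¹' K) = ∫⁻ x, K.indicator 1 x.coord ∂haar := by
    rw [← lintegral_indicator_one (U.measurable_coord hK.measurableSet)]
    rfl
  rw [e1, lintegral_haar (measurable_one.indicator hK.measurableSet)]
  calc ∫⁻ z, ENNReal.ofReal (1 / z.2 ^ 2)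
        * Set.indicator {z : ℝ × ℝ | 0 < z.2} (K.indicator 1) z
      ≤ ∫⁻ z, K.indicator (fun _ => ENNReal.ofReal (1 / z₀.2 ^ 2)) z := by
        refine lintegral_mono fun z => ?_
        by_cases hz : z ∈ K
        · have h1 : z₀.2 ≤ z.2 := hmin hz
          rw [Set.indicator_of_mem (hpos hz), Set.indicator_of_mem hz, Set.indicator_of_mem hz]
          simp only [Pi.one_apply, mul_one]
          gcongr
        · have : Set.indicator {z : ℝ × ℝ | 0 < z.2} (K.indicator (1 : ℝ × ℝ → ℝ≥0∞)) z = 0 := by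
            simp [Set.indicator_apply, hz]
          simp [this]
    _ = ENNReal.ofReal (1 / z₀.2 ^ 2) * volume K := by
        rw [lintegral_indicator hK.measurableSet, setLIntegral_const]
    _ < ∞ := ENNReal.mul_lt_top ENNReal.ofReal_lt_top hK.measure_lt_top

lemma IsTest.measurable {f : U → ℂ} (hf : IsTest f) : Measurable f := by
  obtain ⟨F, hF, -, -, h⟩ := hf
  rw [show f = fun x => F x.coord from funext h]
  exact hF.continuous.measurable.comp U.measurable_coord

lemma IsTest.exists_bound {f : U → ℂ} (hf : IsTest f) : ∃ C : ℝ, ∀ x, ‖f x‖ ≤ C := by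
  obtain ⟨F, hF, hc, -, h⟩ := hf
  obtain ⟨C, hC⟩ := hF.continuous.bounded_above_of_compact_support hc
  exact ⟨C, fun x => by rw [h]; exact hC _⟩

lemma IsTest.integrable {f : U → ℂ} (hf : IsTest f) : Integrable f haar := by
  obtain ⟨C, hC⟩ := hf.exists_bound
  have hm := hf.measurable
  obtain ⟨F, hF, hc, hpos, h⟩ := hf
  have hsupp : Function.support f ⊆ U.coord ⁻¹' tsupport F := fun x hx => by
    rw [Function.mem_support, h] at hx
    exact subset_tsupport F hx
  rw [← integrableOn_iff_integrable_of_support_subset hsupp]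
  exact Measure.integrableOn_of_bounded (haar_preimage_lt_top hc.isCompact hpos).ne
    hm.aestronglyMeasurable (Filter.Eventually.of_forall hC)

lemma IsTest.memLp {f : U → ℂ} (hf : IsTest f) : MemLp f 2 haar := by
  obtain ⟨C, hC⟩ := hf.exists_bound
  have h1 : MemLp f 1 haar := memLp_one_iff_integrable.mpr hf.integrable
  have h2 : MemLp f ∞ haar := memLp_top_of_bound hf.measurable.aestronglyMeasurable C
    (Filter.Eventually.of_forall hC)
  rw [memLp_two_iff_integrable_sq_norm hf.measurable.aestronglyMeasurable]
  have := hf.integrable.norm.bdd_mul (f := fun x => ‖f x‖) (c := C)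
    hf.measurable.norm.aestronglyMeasurable
    (Filter.Eventually.of_forall fun x => by simpa using hC x)
  simpa only [sq] using this

/-- The factor `a` produced by commuting `K` past `ρ(y)` can thus be absorbed into `f`. -/
lemma IsTest.mul_a {f : U → ℂ} (hf : IsTest f) : IsTest fun x => (x.a : ℂ) * f x := by
  obtain ⟨F, hF, hc, hpos, h⟩ := hf
  refine ⟨fun z => (z.2 : ℂ) * F z, ?_, hc.mul_left, ?_, fun x => ?_⟩
  · exact (Complex.ofRealCLM.contDiff.comp contDiff_snd).mul hF
  · exact (closure_mono (Function.support_mul_subset_right _ _)).trans hpos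
  · simp only [h]
    rfl

/-! Weak and strong measurability -/

/-- Distinct basis vectors are at distance at least 1, so the balls of radius 1/2 around them form a
disjoint family of nonempty open sets, countable by second countability. -/
lemma countable_of_hilbertBasis {ι E : Type*} [NormedAddCommGroup E] [InnerProductSpace ℂ E]
    [SecondCountableTopology E] (e : HilbertBasis ι ℂ E) : Countable ι := by
  have hd : (Set.univ : Set ι).PairwiseDisjoint fun i => Metric.ball (e i) (1 / 2) := by
    intro i _ j _ hij
    refine Set.disjoint_left.mpr fun x hi hj => ?_
    have h1 : dist (e i) (e j) < 1 := by
      calc dist (e i) (e j) ≤ dist x (e i) + dist x (e j) := dist_triangle_left _ _ _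
        _ < 1 / 2 + 1 / 2 := add_lt_add hi hj
        _ = 1 := by norm_num
    have h2 : ‖⟪e i, e i - e j⟫_ℂ‖ ≤ ‖e i‖ * ‖e i - e j‖ := norm_inner_le_norm _ _
    rw [inner_sub_right, e.orthonormal.2 hij, inner_self_eq_norm_sq_to_K, e.orthonormal.1 i,
      sub_zero, one_mul, ← dist_eq_norm (e i)] at h2
    simp only [Complex.coe_algebraMap, Complex.ofReal_one, one_pow, norm_one] at h2
    linarith
  exact Set.countable_univ_iff.mp (hd.countable_of_isOpen (fun _ _ => Metric.isOpen_ball)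
    fun i _ => ⟨e i, Metric.mem_ball_self (by norm_num)⟩)

/-- In a separable Hilbert space, weakly measurable functions are strongly measurable. -/
lemma stronglyMeasurable_of_inner {α E : Type*} [MeasurableSpace α] [NormedAddCommGroup E]
    [InnerProductSpace ℂ E] [CompleteSpace E] [SecondCountableTopology E] {f : α → E}
    (hf : ∀ w : E, Measurable fun x => ⟪w, f x⟫_ℂ) : StronglyMeasurable f := by
  obtain ⟨ι, e, -⟩ := exists_hilbertBasis ℂ E
  have : Countable ι := countable_of_hilbertBasis e
  refine stronglyMeasurable_of_tendsto (Filter.atTop : Filter (Finset ι))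
    (f := fun s x => ∑ i ∈ s, ⟪e i, f x⟫_ℂ • e i) (fun s => ?_) ?_
  · exact Finset.stronglyMeasurable_fun_sum s fun i _ =>
      (hf (e i)).stronglyMeasurable.smul_const (e i)
  · rw [tendsto_pi_nhds]
    intro x
    have h := e.hasSum_repr (f x)
    simpa only [HasSum, SummationFilter.unconditional_filter, HilbertBasis.repr_apply_apply] using h

/-! The representations and the Duflo–Moore operators -/

instance (ε : Bool) : SigmaFinite (leb ε) := by
  unfold leb
  infer_instance

lemma coeFn_rep (ε : Bool) (y : U) (φ : H ε) : rep ε y φ =ᵐ[leb ε] repFun y φ :=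
  MemLp.coeFn_toLp (memLp_repFun ε y φ)

/-- The inner product is an integral over `s` of a jointly measurable function of `(y, s)`, hence
measurable in the parameter `y`. -/
lemma measurable_inner_rep (ε : Bool) (w φ : H ε) : Measurable fun y => ⟪w, rep ε y φ⟫_ℂ := by
  have h : (fun y => ⟪w, rep ε y φ⟫_ℂ) = fun y => ∫ s, ⟪w s, repFun y φ s⟫_ℂ ∂(leb ε) := by
    ext y
    rw [L2.inner_def]
    refine integral_congr_ae ?_
    filter_upwards [coeFn_rep ε y φ] with s hs
    rw [hs]
  rw [h]
  have hφ : Measurable φ := (Lp.stronglyMeasurable φ).measurable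
  have hw : Measurable w := (Lp.stronglyMeasurable w).measurable
  have hm : Measurable fun q : U × ℝ => ⟪w q.2, repFun q.1 φ q.2⟫_ℂ := by
    simp only [repFun, RCLike.inner_apply]
    fun_prop
  exact (hm.stronglyMeasurable.integral_prod_right' (ν := leb ε)).measurable

lemma stronglyMeasurable_rep (ε : Bool) (φ : H ε) : StronglyMeasurable fun y => rep ε y φ :=
  -- Finiteness of the exponent is what makes `H ε` separable.
  have : Fact ((2 : ℝ≥0∞) ≠ ∞) := ⟨ENNReal.ofNat_ne_top⟩
  stronglyMeasurable_of_inner fun w => measurable_inner_rep ε w φ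

lemma coeFn_dufloMoore (ε : Bool) (r : ℝ) (φ : (dufloMoore ε r).domain) :
    dufloMoore ε r φ =ᵐ[leb ε] fun s => ((|s| ^ r : ℝ) : ℂ) * (φ : H ε) s :=
  MemLp.coeFn_toLp φ.2

lemma inner_dufloMoore (ε : Bool) (r : ℝ) (ψ φ : (dufloMoore ε r).domain) :
    ⟪dufloMoore ε r ψ, (φ : H ε)⟫_ℂ = ⟪(ψ : H ε), dufloMoore ε r φ⟫_ℂ := by
  rw [L2.inner_def, L2.inner_def]
  refine integral_congr_ae ?_
  filter_upwards [coeFn_dufloMoore ε r ψ, coeFn_dufloMoore ε r φ] with s h1 h2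
  rw [h1, h2]
  simp only [RCLike.inner_apply, map_mul, Complex.conj_ofReal]
  ring

/-- `ρ(y) K = a K ρ(y)` for `y = (b, a)`, in weak form. -/
lemma inner_rep_dufloMoore (ε : Bool) (y : U) (ψ φ : (dufloMoore ε 1).domain) :
    ⟪(ψ : H ε), rep ε y (dufloMoore ε 1 φ)⟫_ℂ = y.a * ⟪dufloMoore ε 1 ψ, rep ε y φ⟫_ℂ := by
  rw [L2.inner_def, L2.inner_def, ← integral_const_mul]
  refine integral_congr_ae ?_
  filter_upwards [coeFn_dufloMoore ε 1 ψ, coeFn_rep ε y φ, coeFn_rep ε y (dufloMoore ε 1 φ),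
    ae_comp ε y (coeFn_dufloMoore ε 1 φ)] with s h1 h2 h3 h4
  rw [h1, h2, h3]
  simp only [repFun, h4, RCLike.inner_apply, map_mul, Complex.conj_ofReal, Real.rpow_one, abs_mul,
    abs_of_pos y.pos]
  push_cast
  ring

/-- If `ψ` is orthogonal to the domain, test it against `ψ / (1 + |s|)`, which lies in the domain:
then `∫ |ψ|² / (1 + |s|) = 0`, so `ψ = 0`. -/
lemma dense_domain_dufloMoore (ε : Bool) :
    Dense ((dufloMoore ε 1).domain : Set (H ε)) := by
  rw [Submodule.dense_iff_topologicalClosure_eq_top, Submodule.topologicalClosure_eq_top_iff,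
    Submodule.eq_bot_iff]
  intro ψ hψ
  have hc : Continuous fun s : ℝ => (1 + |s|)⁻¹ :=
    Continuous.inv₀ (by fun_prop) fun s => by positivity
  have hm : Continuous fun s : ℝ => (((1 + |s|)⁻¹ : ℝ) : ℂ) :=
    Complex.continuous_ofReal.comp hc
  have hn : ∀ s : ℝ, ‖(((1 + |s|)⁻¹ : ℝ) : ℂ)‖ = (1 + |s|)⁻¹ := fun s => by
    rw [Complex.norm_real, Real.norm_of_nonneg (by positivity)]
  have hψm := Lp.memLp ψ
  have h1 : MemLp (fun s => (((1 + |s|)⁻¹ : ℝ) : ℂ) * ψ s) 2 (leb ε) := by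
    refine MemLp.of_le_mul (c := 1) hψm (hm.aestronglyMeasurable.mul hψm.1) ?_
    refine Filter.Eventually.of_forall fun s => ?_
    rw [norm_mul, hn]
    gcongr
    exact inv_le_one_of_one_le₀ (by linarith [abs_nonneg s])
  have h2 : h1.toLp _ ∈ (dufloMoore ε 1).domain := by
    have : MemLp (fun s => ((|s| ^ (1 : ℝ) : ℝ) : ℂ) * ((((1 + |s|)⁻¹ : ℝ) : ℂ) * ψ s)) 2
        (leb ε) := by
      refine MemLp.of_le_mul (c := 1) hψm (AEStronglyMeasurable.mul
        (Continuous.aestronglyMeasurable ?_) h1.1) ?_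
      · simp only [Real.rpow_one]
        fun_prop
      refine Filter.Eventually.of_forall fun s => ?_
      rw [norm_mul, norm_mul, hn, Real.rpow_one, Complex.norm_real, Real.norm_of_nonneg
        (abs_nonneg s), ← mul_assoc]
      gcongr
      rw [← div_eq_mul_inv, div_le_one (by positivity)]
      linarith
    refine (memLp_congr_ae ?_).mpr this
    filter_upwards [h1.coeFn_toLp] with s hs
    rw [hs]
  have h3 : ⟪ψ, h1.toLp _⟫_ℂ = 0 := (Submodule.mem_orthogonal' _ _).mp hψ _ h2
  have hint : Integrable (fun s => (1 + |s|)⁻¹ * ‖ψ s‖ ^ 2) (leb ε) := by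
    refine Integrable.bdd_mul (c := 1) ?_ ?_ ?_
    · exact (memLp_two_iff_integrable_sq_norm hψm.1).mp hψm
    · exact hc.aestronglyMeasurable
    · refine Filter.Eventually.of_forall fun s => ?_
      rw [Real.norm_of_nonneg (by positivity)]
      exact inv_le_one_of_one_le₀ (by linarith [abs_nonneg s])
  have h4 : ∫ s, (1 + |s|)⁻¹ * ‖ψ s‖ ^ 2 ∂(leb ε) = 0 := by
    rw [L2.inner_def] at h3
    have : ∫ s, (((1 + |s|)⁻¹ * ‖ψ s‖ ^ 2 : ℝ) : ℂ) ∂(leb ε) = 0 := by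
      rw [← h3]
      refine integral_congr_ae ?_
      filter_upwards [h1.coeFn_toLp] with s hs
      rw [hs]
      simp only [RCLike.inner_apply]
      rw [mul_assoc, RCLike.mul_conj]
      push_cast
      rfl
    rw [integral_complex_ofReal] at this
    exact_mod_cast this
  rw [integral_eq_zero_iff_of_nonneg (fun s => by positivity) hint] at h4
  rw [Lp.eq_zero_iff_ae_eq_zero]
  filter_upwards [h4] with s hs
  have h5 : (1 + |s|)⁻¹ ≠ 0 := by positivity
  simpa [h5] using hs

/-- This makes `traceMulK` independent of the extension chosen in its definition. -/
lemma ExtendsMulK.unique {ε : Bool} {A : H ε → H ε} {S T : H ε →L[ℂ] H ε}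
    (hS : ExtendsMulK A 1 S) (hT : ExtendsMulK A 1 T) : S = T := by
  have h : (S : H ε → H ε) = T := Continuous.ext_on (dense_domain_dufloMoore ε) S.continuous
    T.continuous fun φ hφ => (hS ⟨φ, hφ⟩).trans (hT ⟨φ, hφ⟩).symm
  exact DFunLike.coe_injective h

lemma traceMulK_eq {ε : Bool} {A : H ε → H ε} {T : H ε →L[ℂ] H ε} (hT : ExtendsMulK A 1 T) :
    traceMulK A = trace T := by
  have h : ∃ T : H ε →L[ℂ] H ε, ExtendsMulK A 1 T := ⟨T, hT⟩
  rw [traceMulK, dif_pos h, h.choose_spec.unique hT]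

/-! The Wigner transform of test functions -/

section Wigner

variable {f g : U → ℂ}

lemma integrable_mul_shift (hf : IsTest f) (hg : IsTest g) (x : U) :
    Integrable (fun y => f y * g (y⁻¹ * x)) haar := by
  obtain ⟨C, hC⟩ := hg.exists_bound
  exact hf.integrable.mul_bdd (c := C)
    (hg.measurable.comp (measurable_inv.mul_const x)).aestronglyMeasurable
    (Filter.Eventually.of_forall fun y => hC _)

lemma integrable_wigner (hf : IsTest f) (hg : IsTest g) (x : U) (ε : Bool) (φ : H ε) :
    Integrable (fun y => (f y * g (y⁻¹ * x)) • rep ε y φ) haar := by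
  have h := integrable_mul_shift hf hg x
  refine (h.norm.mul_const ‖φ‖).mono'
    (h.aestronglyMeasurable.smul (stronglyMeasurable_rep ε φ).aestronglyMeasurable) ?_
  exact Filter.Eventually.of_forall fun y => by rw [norm_smul, LinearIsometry.norm_map]

lemma inner_wigner (hf : IsTest f) (hg : IsTest g) (x : U) (ε : Bool) (w φ : H ε) :
    ⟪w, wigner f g x ε φ⟫_ℂ = ∫ y, f y * g (y⁻¹ * x) * ⟪w, rep ε y φ⟫_ℂ ∂haar := by
  rw [wigner, ← integral_inner (integrable_wigner hf hg x ε φ)]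
  simp only [inner_smul_right]

/-- The Wigner transform as a bounded operator. -/
def wignerCLM (hf : IsTest f) (hg : IsTest g) (x : U) (ε : Bool) : H ε →L[ℂ] H ε :=
  LinearMap.mkContinuous
    { toFun := wigner f g x ε
      map_add' := fun φ ψ => by
        simp only [wigner, map_add, smul_add]
        exact integral_add (integrable_wigner hf hg x ε φ) (integrable_wigner hf hg x ε ψ)
      map_smul' := fun c φ => by
        simp only [wigner, map_smul, RingHom.id_apply, smul_comm _ c]
        exact integral_smul c _ }
    (∫ y, ‖f y * g (y⁻¹ * x)‖ ∂haar)
    fun φ => by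
      change ‖wigner f g x ε φ‖ ≤ _
      rw [wigner, ← integral_mul_const]
      refine (norm_integral_le_integral_norm _).trans_eq ?_
      simp only [norm_smul, LinearIsometry.norm_map]

lemma wignerCLM_apply (hf : IsTest f) (hg : IsTest g) (x : U) (ε : Bool) (φ : H ε) :
    wignerCLM hf hg x ε φ = wigner f g x ε φ := rfl

end Wigner

/-! Rank one symbols `h(x) ⟨u, ·⟩ u` -/

section RankOneSymbol

open InnerProductSpace

/-- The symbol `x ↦ h(x) ⟨u, ·⟩ u`. -/
def rankOneSymbol (h : U → ℝ) (u : ∀ ε, H ε) : Symbol :=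
  fun x ε => rankOne ℂ ((h x : ℂ) • u ε) (u ε)

variable {h : U → ℝ} {f g : U → ℂ}

lemma rankOneSymbol_apply (h : U → ℝ) (u : ∀ ε, H ε) (x : U) (ε : Bool) (φ : H ε) :
    rankOneSymbol h u x ε φ = (h x * ⟪u ε, φ⟫_ℂ) • u ε := by
  rw [rankOneSymbol, rankOne_apply, smul_smul, mul_comm]

lemma adjoint_rankOneSymbol (h : U → ℝ) (u : ∀ ε, H ε) (x : U) (ε : Bool) :
    ContinuousLinearMap.adjoint (rankOneSymbol h u x ε) = rankOneSymbol h u x ε := by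
  rw [rankOneSymbol, adjoint_rankOne]
  ext1 φ
  simp only [rankOne_apply, inner_smul_left, smul_smul, Complex.conj_ofReal]
  rw [mul_comm]

/-- The operator sends `φ` to `h(x) ⟨u, W(f,g) K φ⟩ u`. By `inner_rep_dufloMoore` the coefficient
equals `h(x) ⟨K u, W(a f, g) φ⟩`, which is bounded in `φ`; taking the adjoint of the Wigner
transform exhibits the rank one form. -/
lemma extendsMulK_symbolWigner (hf : IsTest f) (hg : IsTest g) (u : ∀ ε, (dufloMoore ε 1).domain)
    (x : U) (ε : Bool) :
    ExtendsMulK (symbolWigner (rankOneSymbol h fun ε => u ε) f g x ε) 1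
      (rankOne ℂ (u ε : H ε) (ContinuousLinearMap.adjoint (wignerCLM hf.mul_a hg x ε)
        ((h x : ℂ) • dufloMoore ε 1 (u ε)))) := by
  intro φ
  rw [symbolWigner, adjoint_rankOneSymbol, rankOneSymbol_apply, rankOne_apply,
    ContinuousLinearMap.adjoint_inner_left, wignerCLM_apply, inner_smul_left, Complex.conj_ofReal,
    inner_wigner hf hg, inner_wigner hf.mul_a hg]
  congr 2
  refine integral_congr_ae (Filter.Eventually.of_forall fun y => ?_)
  simp only [inner_rep_dufloMoore]
  ring

lemma traceMulK_symbolWigner (hf : IsTest f) (hg : IsTest g) (u : ∀ ε, (dufloMoore ε 1).domain)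
    (x : U) (ε : Bool) :
    traceMulK (symbolWigner (rankOneSymbol h fun ε => u ε) f g x ε)
      = h x * ∫ y, y.a * f y * g (y⁻¹ * x) * ⟪dufloMoore ε 1 (u ε), rep ε y (u ε)⟫_ℂ ∂haar := by
  rw [traceMulK_eq (extendsMulK_symbolWigner hf hg u x ε), trace_rankOne,
    ContinuousLinearMap.adjoint_inner_left, wignerCLM_apply, inner_smul_left, Complex.conj_ofReal,
    inner_wigner hf.mul_a hg]

lemma traceClassMulK_symbolWigner (hf : IsTest f) (hg : IsTest g)
    (u : ∀ ε, (dufloMoore ε 1).domain) (x : U) (ε : Bool) :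
    TraceClassMulK (symbolWigner (rankOneSymbol h fun ε => u ε) f g x ε) := by
  refine ⟨_, extendsMulK_symbolWigner hf hg u x ε, ?_⟩
  rw [schattenPow_rankOne le_rfl]
  exact ENNReal.ofReal_lt_top

/-- The function `(y, z) ↦ h(yz) a_y f(y) g(z) ⟨K u, ρ(y) u⟩` on `U × U`. -/
def formIntegrand (h : U → ℝ) (u : ∀ ε, (dufloMoore ε 1).domain) (f g : U → ℂ) (ε : Bool)
    (q : U × U) : ℂ :=
  h (q.1 * q.2) * ((q.1.a * f q.1 * ⟪dufloMoore ε 1 (u ε), rep ε q.1 (u ε)⟫_ℂ) * g q.2)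

lemma integrable_mul_coefficient (hf : IsTest f) (ε : Bool) (w φ : H ε) :
    Integrable (fun y => f y * ⟪w, rep ε y φ⟫_ℂ) haar := by
  refine hf.integrable.mul_bdd (c := ‖w‖ * ‖φ‖) (measurable_inner_rep ε w φ).aestronglyMeasurable
    (Filter.Eventually.of_forall fun y => ?_)
  exact (norm_inner_le_norm _ _).trans_eq (by rw [LinearIsometry.norm_map])

lemma integrable_formIntegrand (hh : Measurable h) (hb : ∀ x, |h x| ≤ 1) (hf : IsTest f)
    (hg : IsTest g) (u : ∀ ε, (dufloMoore ε 1).domain) (ε : Bool) :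
    Integrable (formIntegrand h u f g ε) (haar.prod haar) := by
  refine Integrable.bdd_mul (c := 1)
    ((integrable_mul_coefficient hf.mul_a ε _ _).mul_prod hg.integrable) ?_ ?_
  · exact (Complex.measurable_ofReal.comp (hh.comp measurable_mul)).aestronglyMeasurable
  · exact Filter.Eventually.of_forall fun q => by simpa using hb _

lemma formIntegrand_shear (u : ∀ ε, (dufloMoore ε 1).domain) (ε : Bool) (y x : U) :
    formIntegrand h u f g ε (y, y⁻¹ * x)
      = h x * (y.a * f y * g (y⁻¹ * x) * ⟪dufloMoore ε 1 (u ε), rep ε y (u ε)⟫_ℂ) := by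
  simp only [formIntegrand, mul_inv_cancel_left]
  ring

/-- The map `(x, y) ↦ (y, y⁻¹ x)` preserves the product measure by left invariance, so integrability
carries over from the unsheared integrand. -/
lemma integrable_formIntegrand_shear (hh : Measurable h) (hb : ∀ x, |h x| ≤ 1) (hf : IsTest f)
    (hg : IsTest g) (u : ∀ ε, (dufloMoore ε 1).domain) (ε : Bool) :
    Integrable (fun q : U × U => formIntegrand h u f g ε (q.2, q.2⁻¹ * q.1))
      (haar.prod haar) :=
  (measurePreserving_prod_inv_mul_swap haar haar).integrable_comp_of_integrable
    (integrable_formIntegrand hh hb hf hg u ε)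

lemma integrable_traceMulK (hh : Measurable h) (hb : ∀ x, |h x| ≤ 1) (hf : IsTest f)
    (hg : IsTest g) (u : ∀ ε, (dufloMoore ε 1).domain) (ε : Bool) :
    Integrable (fun x => traceMulK (symbolWigner (rankOneSymbol h fun ε => u ε) f g x ε))
      haar := by
  have hi := (integrable_formIntegrand_shear hh hb hf hg u ε).integral_prod_left
  simpa only [formIntegrand_shear, integral_const_mul, ← traceMulK_symbolWigner hf hg] using hi

/-- Fubini and the change of variables `x = yz` decouple `f` and `g`, leaving `h(yz)` as the only
factor that involves both variables. -/
lemma integral_traceMulK (hh : Measurable h) (hb : ∀ x, |h x| ≤ 1) (hf : IsTest f)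
    (hg : IsTest g) (u : ∀ ε, (dufloMoore ε 1).domain) (ε : Bool) :
    ∫ x, traceMulK (symbolWigner (rankOneSymbol h fun ε => u ε) f g x ε) ∂haar
      = ∫ q, formIntegrand h u f g ε q ∂(haar.prod haar) := by
  have hs := integrable_formIntegrand_shear hh hb hf hg u ε
  have hp := measurePreserving_prod_inv_mul_swap haar haar
  have hF := integrable_formIntegrand hh hb hf hg u ε
  rw [← hp.map_eq, integral_map hp.measurable.aemeasurable
    (by rw [hp.map_eq]; exact hF.aestronglyMeasurable), integral_prod _ hs]
  simp only [formIntegrand_shear, integral_const_mul, ← traceMulK_symbolWigner hf hg]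

lemma weylFormExists_rankOneSymbol (hh : Measurable h) (hb : ∀ x, |h x| ≤ 1) (hf : IsTest f)
    (hg : IsTest g) (u : ∀ ε, (dufloMoore ε 1).domain) :
    WeylFormExists (rankOneSymbol h fun ε => u ε) f g := fun ε =>
  ⟨Filter.Eventually.of_forall fun x => traceClassMulK_symbolWigner hf hg u x ε,
    integrable_traceMulK hh hb hf hg u ε⟩

/-- By symmetry of `K^{1/p}`, the operator `σ K^{1/p}` extends to `h(x) ⟨K^{1/p} u, ·⟩ u`, whose
Schatten norm is `|h(x)|` times a constant. -/
lemma memLpSchatten_rankOneSymbol {p : ℝ} (hp : 1 ≤ p) (hh : Measurable h) (u : ∀ ε, H ε)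
    (hu : ∀ ε, u ε ∈ (dufloMoore ε (1 / p)).domain)
    (hint : ∫⁻ x, ENNReal.ofReal (|h x| ^ p) ∂haar < ∞) :
    MemLpSchatten p (rankOneSymbol h u) where
  measurable ε φ ψ := by
    simp only [rankOneSymbol_apply, inner_smul_right]
    have : Measurable fun x => (h x : ℂ) := Complex.measurable_ofReal.comp hh
    exact ((this.mul_const _).mul_const _).aestronglyMeasurable
  mem_schatten x ε := by
    rw [rankOneSymbol, schattenPow_rankOne hp]
    exact ENNReal.ofReal_lt_top
  norm_lt_top := by
    refine ENNReal.sum_lt_top.mpr fun ε _ => ?_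
    set w : H ε := dufloMoore ε (1 / p) ⟨u ε, hu ε⟩ with hw
    have hle : ∀ x, schattenPowMulK p (rankOneSymbol h u x ε) (1 / p)
        ≤ ENNReal.ofReal ((‖u ε‖ * ‖w‖) ^ p) * ENNReal.ofReal (|h x| ^ p) := by
      intro x
      -- One extension bounds the infimum from above, so uniqueness of the extension plays no role
      -- here.
      refine (iInf₂_le (rankOne ℂ ((h x : ℂ) • u ε) w) fun φ => ?_).trans_eq ?_
      · rw [rankOneSymbol, rankOne_apply, rankOne_apply, hw, inner_dufloMoore]
      · rw [schattenPow_rankOne hp, ← ENNReal.ofReal_mul (by positivity),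
          ← Real.mul_rpow (by positivity) (by positivity), norm_smul, Complex.norm_real,
          Real.norm_eq_abs]
        congr 2
        ring
    refine (lintegral_mono hle).trans_lt ?_
    rw [lintegral_const_mul' _ _ ENNReal.ofReal_ne_top]
    exact ENNReal.mul_lt_top ENNReal.ofReal_lt_top hint

end RankOneSymbol

/-! The window functions `1_{1 ≤ |s| ≤ 4}` -/

/-- The set `{1 ≤ |s| ≤ 4}`. -/
def windowSet : Set ℝ := {s | |s| ∈ Set.Icc 1 4}

lemma measurableSet_windowSet : MeasurableSet windowSet :=
  measurable_norm measurableSet_Icc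

lemma leb_windowSet_ne_top (ε : Bool) : leb ε windowSet ≠ ∞ := by
  refine ((Measure.restrict_apply_le _ _).trans_lt ?_).ne
  refine (measure_mono (t := Set.Icc (-4) 4) fun s hs => ?_).trans_lt measure_Icc_lt_top
  exact abs_le.mp hs.2

/-- The indicator function of `{1 ≤ |s| ≤ 4}` on the half line. -/
def window (ε : Bool) : H ε :=
  indicatorConstLp 2 measurableSet_windowSet (leb_windowSet_ne_top ε) 1

lemma coeFn_window (ε : Bool) : window ε =ᵐ[leb ε] windowSet.indicator fun _ => (1 : ℂ) :=
  indicatorConstLp_coeFn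

lemma window_mem_domain (ε : Bool) {r : ℝ} (hr : 0 ≤ r) : window ε ∈ (dufloMoore ε r).domain := by
  have hw := Lp.memLp (window ε)
  have hm : Measurable fun s : ℝ => ((|s| ^ r : ℝ) : ℂ) := by fun_prop
  refine MemLp.of_le_mul (c := 4 ^ r) hw (hm.aestronglyMeasurable.mul hw.1) ?_
  filter_upwards [coeFn_window ε] with s hs
  rw [hs, norm_mul]
  by_cases h : s ∈ windowSet
  · rw [Complex.norm_real, Real.norm_of_nonneg (by positivity)]
    gcongr
    exact h.2
  · simp [h]

/-- The window functions as elements of the domain of `K`. -/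
def domWindow (ε : Bool) : (dufloMoore ε 1).domain := ⟨window ε, window_mem_domain ε zero_le_one⟩

/-- The matrix coefficient `⟨K u, ρ(y) u⟩` of the window function `u`. -/
def windowCoeff (ε : Bool) (y : U) : ℂ :=
  ⟪dufloMoore ε 1 (domWindow ε), rep ε y (domWindow ε)⟫_ℂ

lemma leb_annulus_pos (ε : Bool) : 0 < leb ε {s | |s| ∈ Set.Icc 2 3} := by
  have hm : MeasurableSet {s : ℝ | |s| ∈ Set.Icc 2 3} := measurable_norm measurableSet_Icc
  rw [leb, Measure.restrict_apply hm]
  cases ε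
  · refine lt_of_lt_of_le ?_ (measure_mono (s := Set.Icc (-3) (-2)) fun s hs => ?_)
    · rw [Real.volume_Icc]
      norm_num
    · have : s < 0 := by linarith [hs.2]
      refine ⟨?_, this⟩
      rw [Set.mem_ofPred_eq, abs_of_neg this]
      constructor <;> linarith [hs.1, hs.2]
  · refine lt_of_lt_of_le ?_ (measure_mono (s := Set.Icc 2 3) fun s hs => ?_)
    · rw [Real.volume_Icc]
      norm_num
    · have : 0 < s := by linarith [hs.1]
      refine ⟨?_, this⟩
      rw [Set.mem_ofPred_eq, abs_of_pos this]
      exact hs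

/-- The real part is the integral of `|s| √a cos(bs)` over the `s` for which both `s` and `as` lie
in the window. There `|bs| ≤ 1 < π/2`, so the cosine is positive. -/
lemma re_windowCoeff_pos (ε : Bool) {y : U} (hb : |y.b| ≤ 1 / 4) (ha : |y.a - 1| ≤ 1 / 4) :
    0 < (windowCoeff ε y).re := by
  have ha' := abs_le.mp ha
  have hi : Integrable (fun s => ⟪(dufloMoore ε 1 (domWindow ε) : H ε) s,
      (rep ε y (domWindow ε) : H ε) s⟫_ℂ) (leb ε) := L2.integrable_inner _ _
  set G : ℝ → ℝ := fun s => |s| * windowSet.indicator (fun _ => (1 : ℝ)) s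
    * (Real.sqrt y.a * Real.cos (y.b * s) * windowSet.indicator (fun _ => (1 : ℝ)) (y.a * s))
    with hG
  have hae : (fun s => RCLike.re ⟪(dufloMoore ε 1 (domWindow ε) : H ε) s,
      (rep ε y (domWindow ε) : H ε) s⟫_ℂ) =ᵐ[leb ε] G := by
    filter_upwards [coeFn_dufloMoore ε 1 (domWindow ε), coeFn_rep ε y (domWindow ε),
      coeFn_window ε, ae_comp ε y (coeFn_window ε)] with s h1 h2 h3 h4
    have e : -(Complex.I * y.b * s) = ((-(y.b * s) : ℝ) : ℂ) * Complex.I := by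
      push_cast
      ring
    rw [h1, h2, hG]
    simp only [repFun, domWindow, h3, h4, e, Real.rpow_one, RCLike.inner_apply, map_mul,
      Complex.conj_ofReal]
    have hreal : ∀ s, windowSet.indicator (fun _ => (1 : ℂ)) s
        = ((windowSet.indicator (fun _ => (1 : ℝ)) s : ℝ) : ℂ) := fun s => by
      by_cases h : s ∈ windowSet <;> simp [h]
    rw [hreal, hreal, Complex.conj_ofReal, Complex.exp_mul_I, ← Complex.ofReal_cos,
      ← Complex.ofReal_sin]
    simp only [RCLike.re_to_complex, Complex.mul_re, Complex.mul_im, Complex.add_re,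
      Complex.add_im, Complex.ofReal_re, Complex.ofReal_im, Complex.I_re, Complex.I_im,
      Real.cos_neg]
    ring
  have hre : (windowCoeff ε y).re = ∫ s, G s ∂(leb ε) := by
    rw [windowCoeff, L2.inner_def, ← RCLike.re_to_complex, ← integral_re hi]
    exact integral_congr_ae hae
  have hcos : ∀ s ∈ windowSet, 0 < Real.cos (y.b * s) := fun s hs => by
    refine Real.cos_pos_of_mem_Ioo (abs_lt.mp ?_)
    rw [abs_mul]
    calc |y.b| * |s| ≤ 1 / 4 * 4 := mul_le_mul hb hs.2 (abs_nonneg s) (by norm_num)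
      _ < Real.pi / 2 := by linarith [Real.pi_gt_three]
  have hnn : 0 ≤ G := fun s => by
    by_cases h : s ∈ windowSet
    · have := (hcos s h).le
      have h' : 0 ≤ windowSet.indicator (fun _ => (1 : ℝ)) (y.a * s) :=
        Set.indicator_nonneg (fun _ _ => zero_le_one) _
      simp only [hG, Pi.zero_apply, Set.indicator_of_mem h]
      positivity
    · simp [hG, h]
  rw [hre, integral_pos_iff_support_of_nonneg hnn (hi.re.congr hae)]
  -- For `3/4 ≤ a ≤ 5/4`, dilation by `a` maps `{2 ≤ |s| ≤ 3}` into the window, so the integrand is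
  -- nonzero on this annulus.
  refine (leb_annulus_pos ε).trans_le (measure_mono fun s hs => ?_)
  have h1 : s ∈ windowSet := ⟨by linarith [hs.1], by linarith [hs.2]⟩
  have h2 : y.a * s ∈ windowSet := by
    change |y.a * s| ∈ Set.Icc 1 4
    rw [abs_mul, abs_of_pos y.pos]
    constructor
    · nlinarith [hs.1]
    · nlinarith [hs.2, hs.1]
  have h3 : 0 < |s| := by linarith [hs.1]
  have h4 := Real.sqrt_pos.mpr y.pos
  have h5 := hcos s h1
  simp only [hG, Function.mem_support, Set.indicator_of_mem h1, Set.indicator_of_mem h2]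
  positivity

/-! A slowly decaying function in `L^p(U)` -/

/-- The function `(1 + |b|)^{-t} 1_{1/2 ≤ a ≤ 2}`. -/
def decay (t : ℝ) (x : U) : ℝ :=
  (Set.Icc (1 / 2) 2).indicator (fun _ => (1 : ℝ)) x.a * (1 + |x.b|) ^ (-t)

lemma measurable_decay (t : ℝ) : Measurable (decay t) := by
  have h : Measurable ((Set.Icc (1 / 2 : ℝ) 2).indicator fun _ => (1 : ℝ)) :=
    measurable_const.indicator measurableSet_Icc
  exact (h.comp U.measurable_a).mul (by fun_prop)

lemma decay_nonneg (t : ℝ) (x : U) : 0 ≤ decay t x :=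
  mul_nonneg (Set.indicator_nonneg (fun _ _ => zero_le_one) _) (by positivity)

lemma abs_decay_le_one {t : ℝ} (ht : 0 ≤ t) (x : U) : |decay t x| ≤ 1 := by
  rw [abs_of_nonneg (decay_nonneg t x)]
  refine mul_le_one₀ (Set.indicator_le' (fun _ _ => le_rfl) (fun _ _ => zero_le_one) _)
    (by positivity) ?_
  exact Real.rpow_le_one_of_one_le_of_nonpos (by linarith [abs_nonneg x.b]) (by linarith)

/-- On `1/2 ≤ a ≤ 2` the density is at most 4, so a product integral dominates; its `b`-factor is
finite exactly because the exponent `tp` exceeds 1. -/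
lemma lintegral_decay_lt_top {p t : ℝ} (hp : 0 < p) (h : 1 < t * p) :
    ∫⁻ x, ENNReal.ofReal (|decay t x| ^ p) ∂haar < ∞ := by
  set F : ℝ × ℝ → ℝ≥0∞ := fun z =>
    ENNReal.ofReal ((1 + |z.1|) ^ (-(t * p))) * (Set.Icc (1 / 2 : ℝ) 2).indicator 1 z.2 with hF
  have hFm : Measurable F := by
    have h : Measurable ((Set.Icc (1 / 2 : ℝ) 2).indicator (1 : ℝ → ℝ≥0∞)) :=
      measurable_one.indicator measurableSet_Icc
    exact Measurable.mul (by fun_prop) (h.comp measurable_snd)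
  have e : ∀ x : U, ENNReal.ofReal (|decay t x| ^ p) = F x.coord := by
    intro x
    rw [abs_of_nonneg (decay_nonneg t x)]
    simp only [decay, hF, U.coord]
    by_cases hx : x.a ∈ Set.Icc (1 / 2 : ℝ) 2
    · simp only [Set.indicator_of_mem hx, one_mul, Pi.one_apply, mul_one]
      rw [← Real.rpow_mul (by positivity), neg_mul]
    · simp only [Set.indicator_of_notMem hx, zero_mul, mul_zero, Real.zero_rpow hp.ne',
        ENNReal.ofReal_zero]
  simp_rw [e]
  rw [lintegral_haar hFm]
  have hle : ∀ z : ℝ × ℝ, ENNReal.ofReal (1 / z.2 ^ 2)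
      * Set.indicator {z : ℝ × ℝ | 0 < z.2} F z
      ≤ ENNReal.ofReal ((1 + |z.1|) ^ (-(t * p)))
        * (Set.Icc (1 / 2 : ℝ) 2).indicator (fun _ => 4) z.2 := by
    intro z
    by_cases hz : z.2 ∈ Set.Icc (1 / 2 : ℝ) 2
    · have hz' : z ∈ {z : ℝ × ℝ | 0 < z.2} := by
        change 0 < z.2
        linarith [hz.1]
      rw [Set.indicator_of_mem hz', Set.indicator_of_mem hz, hF]
      simp only [Set.indicator_of_mem hz, Pi.one_apply, mul_one]
      rw [mul_comm]
      gcongr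
      refine (ENNReal.ofReal_le_ofReal (q := 4) ?_).trans_eq (by simp)
      rw [div_le_iff₀ (by have := hz.1; positivity)]
      nlinarith [hz.1]
    · have : Set.indicator {z : ℝ × ℝ | 0 < z.2} F z = 0 := by
        refine Set.indicator_apply_eq_zero.mpr fun _ => ?_
        simp only [hF, Set.indicator_of_notMem hz, mul_zero]
      rw [this, mul_zero]
      exact zero_le
  refine (lintegral_mono hle).trans_lt ?_
  rw [Measure.volume_eq_prod, lintegral_prod_mul
    (f := fun b : ℝ => ENNReal.ofReal ((1 + |b|) ^ (-(t * p))))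
    (g := (Set.Icc (1 / 2 : ℝ) 2).indicator fun _ => (4 : ℝ≥0∞)) (by fun_prop)
    (measurable_const.indicator measurableSet_Icc).aemeasurable]
  refine ENNReal.mul_lt_top ?_ ?_
  · have hi : Integrable (fun b : ℝ => (1 + ‖b‖) ^ (-(t * p))) :=
      integrable_one_add_norm (by simpa using h)
    simpa only [Real.norm_eq_abs] using hi.lintegral_lt_top
  · rw [lintegral_indicator measurableSet_Icc, setLIntegral_const]
    exact ENNReal.mul_lt_top (by simp) measure_Icc_lt_top

/-! Bump functions -/

/-- A smooth bump function on the half plane around the point `(0, 1)`. -/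
def bump : ContDiffBump ((0, 1) : ℝ × ℝ) := ⟨1 / 8, 1 / 4, by norm_num, by norm_num⟩

/-- The bump function stretched by the factor `c⁻¹` in the `b`-direction. -/
def wideBump (c : ℝ) (x : U) : ℝ := bump (c * x.b, x.a)

lemma wideBump_nonneg (c : ℝ) (x : U) : 0 ≤ wideBump c x := bump.nonneg

lemma bump_eq_zero_or (z : ℝ × ℝ) : bump z = 0 ∨ |z.1| ≤ 1 / 4 ∧ |z.2 - 1| ≤ 1 / 4 := by
  by_cases h : bump z = 0
  · exact Or.inl h
  · have hz : z ∈ Function.support bump := h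
    rw [bump.support_eq, Metric.mem_ball, Prod.dist_eq, max_lt_iff, Real.dist_eq, Real.dist_eq,
      sub_zero] at hz
    exact Or.inr ⟨hz.1.le, hz.2.le⟩

lemma isTest_wideBump {c : ℝ} (hc : 0 < c) : IsTest fun x => (wideBump c x : ℂ) := by
  set F : ℝ × ℝ → ℂ := fun z => (bump (c * z.1, z.2) : ℂ) with hF
  set K : Set (ℝ × ℝ) := Set.Icc (-(1 / 4 / c)) (1 / 4 / c) ×ˢ Set.Icc (3 / 4) (5 / 4) with hK
  have hKc : IsCompact K := isCompact_Icc.prod isCompact_Icc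
  have hsupp : Function.support F ⊆ K := fun z hz => by
    rcases bump_eq_zero_or (c * z.1, z.2) with h | ⟨h1, h2⟩
    · exact absurd (by simp [hF, h]) hz
    · refine ⟨abs_le.mp ?_, ?_⟩
      · rw [le_div_iff₀ hc, mul_comm]
        rwa [abs_mul, abs_of_pos hc] at h1
      · have := abs_le.mp h2
        constructor <;> linarith [this.1, this.2]
  refine ⟨F, ?_, HasCompactSupport.of_support_subset_isCompact hKc hsupp,
    (closure_minimal hsupp hKc.isClosed).trans fun z hz => ?_, fun x => rfl⟩
  · exact Complex.ofRealCLM.contDiff.comp (bump.contDiff.comp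
      ((contDiff_const.mul contDiff_fst).prodMk contDiff_snd))
  · have h3 : (3 / 4 : ℝ) ≤ z.2 := hz.2.1
    change 0 < z.2
    linarith

/-- Applied with the identity and with the square, this gives the growth of the integral and of the
squared `L²` norm of the wide bump: both are linear in `c⁻¹`. -/
lemma integral_comp_wideBump (φ : ℝ → ℝ) (hφ : Continuous φ) {c : ℝ} (hc : 0 < c) :
    ∫ x, φ (wideBump c x) ∂haar = c⁻¹ * ∫ x, φ (wideBump 1 x) ∂haar := by
  have hm : Measurable fun x => φ (wideBump 1 x) := by
    have h1 : Measurable bump := bump.continuous.measurable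
    have h2 : Measurable (wideBump 1) := h1.comp (by fun_prop)
    exact hφ.measurable.comp h2
  have h := integral_map (μ := haar) (U.measurable_stretch 0 c 1 one_pos).aemeasurable
    (f := fun x => φ (wideBump 1 x)) hm.aestronglyMeasurable
  rw [map_stretch_haar 0 hc one_pos, integral_smul_measure, one_div,
    ENNReal.toReal_ofReal (inv_pos.mpr hc).le, smul_eq_mul] at h
  rw [h]
  refine integral_congr_ae (Filter.Eventually.of_forall fun x => ?_)
  simp [wideBump, U.stretch]

lemma haar_support_wideBump_pos : 0 < haar (Function.support (wideBump 1)) := by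
  have hs : Function.support (wideBump 1) = U.coord ⁻¹' Metric.ball (0, 1) (1 / 4) := by
    ext x
    have h : x.coord ∈ Function.support bump ↔ x.coord ∈ Metric.ball (0, 1) (1 / 4) := by
      rw [bump.support_eq]
      rfl
    simpa [wideBump, U.coord] using h
  have hpos : Metric.ball ((0, 1) : ℝ × ℝ) (1 / 4) ⊆ {z : ℝ × ℝ | 0 < z.2} := fun z hz => by
    rw [Metric.mem_ball, Prod.dist_eq, max_lt_iff, Real.dist_eq, Real.dist_eq] at hz
    change 0 < z.2
    linarith [(abs_lt.mp hz.2).1]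
  rw [pos_iff_ne_zero, hs, ← Measure.map_apply U.measurable_coord measurableSet_ball,
    map_coord_haar, Measure.restrict_apply measurableSet_ball, Set.inter_eq_left.mpr hpos, Ne,
    withDensity_apply_eq_zero measurable_density]
  have hsub : Metric.ball ((0, 1) : ℝ × ℝ) (1 / 4)
      ⊆ {z | ENNReal.ofReal (1 / z.2 ^ 2) ≠ 0} ∩ Metric.ball ((0, 1) : ℝ × ℝ) (1 / 4) :=
    fun z hz => ⟨by
      have : 0 < z.2 := hpos hz
      have h : 0 < 1 / z.2 ^ 2 := by positivity
      exact (ENNReal.ofReal_pos.mpr h).ne', hz⟩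
  exact ((Metric.measure_ball_pos volume _ (by norm_num)).trans_le (measure_mono hsub)).ne'

lemma integral_wideBump_one_pos : 0 < ∫ x, wideBump 1 x ∂haar := by
  rw [integral_pos_iff_support_of_nonneg (wideBump_nonneg 1)
    (by simpa using (isTest_wideBump one_pos).integrable.re)]
  exact haar_support_wideBump_pos

/-! Lower and upper bounds for the Weyl form -/

/-- The symbol `(1 + |b|)^{-t} 1_{1/2 ≤ a ≤ 2} ⟨u, ·⟩ u` built on the window functions `u`. -/
def decaySymbol (t : ℝ) : Symbol := rankOneSymbol (decay t) fun ε => domWindow ε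

/-- The integral of `a_y f(y) Re ⟨K u, ρ(y) u⟩` for the bump function `f`. -/
def bumpCoeff (ε : Bool) : ℝ := ∫ y, y.a * wideBump 1 y * (windowCoeff ε y).re ∂haar

lemma wideBump_eq_zero_or {c : ℝ} (hc : 0 < c) (x : U) :
    wideBump c x = 0 ∨ |x.b| ≤ 1 / 4 / c ∧ |x.a - 1| ≤ 1 / 4 := by
  refine (bump_eq_zero_or (c * x.b, x.a)).imp_right fun h => ⟨?_, h.2⟩
  rw [le_div_iff₀ hc, mul_comm]
  have := h.1
  rwa [abs_mul, abs_of_pos hc] at this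

lemma mul_re_windowCoeff_nonneg (ε : Bool) (y : U) :
    0 ≤ y.a * wideBump 1 y * (windowCoeff ε y).re := by
  rcases wideBump_eq_zero_or one_pos y with h | ⟨h1, h2⟩
  · simp [h]
  · exact mul_nonneg (mul_nonneg y.pos.le (wideBump_nonneg 1 y))
      (re_windowCoeff_pos ε (by simpa using h1) h2).le

lemma integrable_mul_re_windowCoeff (ε : Bool) :
    Integrable (fun y => y.a * wideBump 1 y * (windowCoeff ε y).re) haar := by
  have h := (integrable_mul_coefficient (isTest_wideBump one_pos).mul_a ε
    (dufloMoore ε 1 (domWindow ε)) (domWindow ε)).re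
  refine h.congr (Filter.Eventually.of_forall fun y => ?_)
  simp only [windowCoeff, ← Complex.ofReal_mul, RCLike.re_to_complex, Complex.re_ofReal_mul]

lemma bumpCoeff_pos (ε : Bool) : 0 < bumpCoeff ε := by
  rw [bumpCoeff, integral_pos_iff_support_of_nonneg (mul_re_windowCoeff_nonneg ε)
    (integrable_mul_re_windowCoeff ε)]
  refine haar_support_wideBump_pos.trans_le (measure_mono fun y hy => ?_)
  rcases wideBump_eq_zero_or one_pos y with h | ⟨h1, h2⟩
  · exact absurd h hy
  · exact mul_ne_zero (mul_ne_zero y.pos.ne' hy)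
      (re_windowCoeff_pos ε (by simpa using h1) h2).ne'

/-- The product `yz` has `a`-coordinate in `[9/16, 25/16]`, and its `b`-coordinate is at most `1/4 +
5n/16 ≤ n` in absolute value. -/
lemma le_decay_mul {t n : ℝ} (ht : 0 ≤ t) (hn : 1 ≤ n) {y z : U} (hyb : |y.b| ≤ 1 / 4)
    (hya : |y.a - 1| ≤ 1 / 4) (hzb : |z.b| ≤ n / 4) (hza : |z.a - 1| ≤ 1 / 4) :
    (1 + n) ^ (-t) ≤ decay t (y * z) := by
  have h1 := abs_le.mp hya
  have h2 := abs_le.mp hza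
  have hmem : (y * z).a ∈ Set.Icc (1 / 2 : ℝ) 2 := by
    rw [U.mul_a]
    constructor <;> nlinarith
  rw [decay, Set.indicator_of_mem hmem, one_mul]
  refine Real.rpow_le_rpow_of_nonpos (by positivity) ?_ (by linarith)
  have h3 : |y.a * z.b| ≤ 5 / 4 * (n / 4) := by
    rw [abs_mul, abs_of_pos y.pos]
    exact mul_le_mul (by linarith) hzb (abs_nonneg _) (by norm_num)
  have h4 : |(y * z).b| ≤ |y.b| + |y.a * z.b| := by
    rw [U.mul_b]
    exact abs_add_le _ _
  linarith

lemma le_re_weylForm {t n : ℝ} (ht : 0 ≤ t) (hn : 1 ≤ n) :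
    (∑ ε, bumpCoeff ε) * (∫ x, wideBump 1 x ∂haar) * (n * (1 + n) ^ (-t))
      ≤ (weylForm (decaySymbol t) (fun x => (wideBump 1 x : ℂ))
        fun x => (wideBump n⁻¹ x : ℂ)).re := by
  have hn0 : 0 < n := by linarith
  have hf := isTest_wideBump one_pos
  have hg := isTest_wideBump (inv_pos.mpr hn0)
  rw [weylForm, Complex.re_sum, Finset.sum_mul, Finset.sum_mul]
  refine Finset.sum_le_sum fun ε _ => ?_
  have hi := integrable_formIntegrand (measurable_decay t) (abs_decay_le_one ht) hf hg domWindow ε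
  rw [decaySymbol, integral_traceMulK (measurable_decay t) (abs_decay_le_one ht) hf hg,
    ← RCLike.re_to_complex, ← integral_re hi]
  have hgi : Integrable (wideBump n⁻¹) haar := by simpa using hg.integrable.re
  have hint : ∫ x, wideBump n⁻¹ x ∂haar = n * ∫ x, wideBump 1 x ∂haar := by
    simpa using integral_comp_wideBump id continuous_id (inv_pos.mpr hn0)
  calc bumpCoeff ε * (∫ x, wideBump 1 x ∂haar) * (n * (1 + n) ^ (-t))
      = (1 + n) ^ (-t) * ((∫ y, y.a * wideBump 1 y * (windowCoeff ε y).re ∂haar)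
          * ∫ x, wideBump n⁻¹ x ∂haar) := by
        rw [hint, bumpCoeff]
        ring
    _ = ∫ q : U × U, (1 + n) ^ (-t) * ((q.1.a * wideBump 1 q.1 * (windowCoeff ε q.1).re)
          * wideBump n⁻¹ q.2) ∂(haar.prod haar) := by
        rw [integral_const_mul, integral_prod_mul
          (fun y : U => y.a * wideBump 1 y * (windowCoeff ε y).re) (wideBump n⁻¹)]
    _ ≤ _ := by
        refine integral_mono
          (((integrable_mul_re_windowCoeff ε).mul_prod hgi).const_mul _) hi.re fun q => ?_
        have e : RCLike.re (formIntegrand (decay t) domWindow (fun x => (wideBump 1 x : ℂ))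
            (fun x => (wideBump n⁻¹ x : ℂ)) ε q) = decay t (q.1 * q.2)
              * ((q.1.a * wideBump 1 q.1 * (windowCoeff ε q.1).re) * wideBump n⁻¹ q.2) := by
          simp only [formIntegrand, windowCoeff, RCLike.re_to_complex, ← Complex.ofReal_mul,
            Complex.re_ofReal_mul, Complex.re_mul_ofReal]
        simp only [e]
        -- Off the supports of the two bumps both integrands vanish, so a lower bound for the decay
        -- factor is needed only where `le_decay_mul` applies.
        rcases wideBump_eq_zero_or one_pos q.1 with h | ⟨h1, h2⟩
        · simp [h]
        rcases wideBump_eq_zero_or (inv_pos.mpr hn0) q.2 with h | ⟨h3, h4⟩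
        · simp [h]
        refine mul_le_mul_of_nonneg_right
          (le_decay_mul ht hn (by simpa using h1) h2 (h3.trans_eq ?_) h4)
          (mul_nonneg (mul_re_windowCoeff_nonneg ε q.1) (wideBump_nonneg _ _))
        rw [div_inv_eq_mul]
        ring

/-- Cauchy–Schwarz for `⟨g_n, T f⟩`, with `g_n` real. Since `f` stays fixed, only `‖g_n‖_2` depends
on `n`. -/
lemma norm_weylForm_le {σ : Symbol} {T : Lp ℂ 2 haar →L[ℂ] Lp ℂ 2 haar}
    (hT : IsWeylTransform σ T) :
    ∃ C : ℝ, ∀ n : ℝ, 0 < n → ‖weylForm σ (fun x => (wideBump 1 x : ℂ))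
      fun x => (wideBump n⁻¹ x : ℂ)‖ ≤ C * n ^ (1 / 2 : ℝ) := by
  have hf := isTest_wideBump one_pos
  set F : Lp ℂ 2 haar := hf.memLp.toLp _ with hF
  set D : ℝ := ∫ x, wideBump 1 x ^ 2 ∂haar
  refine ⟨Real.sqrt D * ‖T F‖, fun n hn => ?_⟩
  have hg := isTest_wideBump (inv_pos.mpr hn)
  set G : Lp ℂ 2 haar := hg.memLp.toLp _ with hG
  have hGae : G =ᵐ[haar] fun x => (wideBump n⁻¹ x : ℂ) := hg.memLp.coeFn_toLp
  have hnorm : ‖G‖ ^ 2 = n * D := by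
    have h1 : ((‖G‖ ^ 2 : ℝ) : ℂ) = ((n * D : ℝ) : ℂ) := by
      have h2 : ∫ x, wideBump n⁻¹ x ^ 2 ∂haar = n * D := by
        have := integral_comp_wideBump (fun s => s ^ 2) (by fun_prop) (inv_pos.mpr hn)
        rwa [inv_inv] at this
      rw [← h2, ← integral_complex_ofReal]
      have h3 := inner_self_eq_norm_sq_to_K (𝕜 := ℂ) G
      rw [L2.inner_def] at h3
      push_cast
      refine h3.symm.trans (integral_congr_ae ?_)
      filter_upwards [hGae] with x hx
      simp only [hx, RCLike.inner_apply, Complex.conj_ofReal]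
      ring
    exact_mod_cast h1
  have hG' : ‖G‖ = Real.sqrt D * n ^ (1 / 2 : ℝ) := by
    rw [← Real.sqrt_eq_rpow, ← Real.sqrt_mul (integral_nonneg fun x => sq_nonneg _), mul_comm,
      ← hnorm, Real.sqrt_sq (norm_nonneg _)]
  rw [← hT _ _ hf hg F hf.memLp.coeFn_toLp]
  have hin : ∫ x, T F x * (wideBump n⁻¹ x : ℂ) ∂haar = ⟪G, T F⟫_ℂ := by
    rw [L2.inner_def]
    refine integral_congr_ae ?_
    filter_upwards [hGae] with x hx
    simp only [hx, RCLike.inner_apply, Complex.conj_ofReal]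
  rw [hin]
  refine (norm_inner_le_norm G (T F)).trans_eq ?_
  rw [hG']
  ring

lemma not_isWeylTransform_decaySymbol {t : ℝ} (ht : 0 ≤ t) (ht' : t < 1 / 2)
    (T : Lp ℂ 2 haar →L[ℂ] Lp ℂ 2 haar) : ¬ IsWeylTransform (decaySymbol t) T := by
  intro hT
  obtain ⟨C, hC⟩ := norm_weylForm_le hT
  set c : ℝ := (∑ ε, bumpCoeff ε) * ∫ x, wideBump 1 x ∂haar with hc
  have hcpos : 0 < c := mul_pos (Finset.sum_pos (fun ε _ => bumpCoeff_pos ε) Finset.univ_nonempty)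
    integral_wideBump_one_pos
  -- Compare the two bounds, using `1 + n ≤ 2n`, and cancel `n ^ (1/2)`: a positive power of `n`
  -- would stay bounded.
  have hle : ∀ n : ℝ, 1 ≤ n → n ^ (1 / 2 - t) ≤ C / (c * 2 ^ (-t)) := by
    intro n hn
    have hn0 : 0 < n := by linarith
    have h1 : c * (n * (1 + n) ^ (-t)) ≤ C * n ^ (1 / 2 : ℝ) :=
      (le_re_weylForm ht hn).trans ((Complex.re_le_norm _).trans (hC n hn0))
    have h2 : (2 * n) ^ (-t) ≤ (1 + n) ^ (-t) :=
      Real.rpow_le_rpow_of_nonpos (by positivity) (by linarith) (by linarith)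
    rw [Real.mul_rpow (by norm_num) hn0.le] at h2
    have h3 : n * n ^ (-t) = n ^ (1 / 2 - t) * n ^ (1 / 2 : ℝ) := by
      rw [← Real.rpow_add hn0, ← Real.rpow_one_add' hn0.le (by linarith)]
      congr 1
      ring
    rw [le_div_iff₀ (by positivity)]
    refine le_of_mul_le_mul_right ?_ (Real.rpow_pos_of_pos hn0 (1 / 2))
    calc n ^ (1 / 2 - t) * (c * 2 ^ (-t)) * n ^ (1 / 2 : ℝ)
        = c * (n * (2 ^ (-t) * n ^ (-t))) := by
          rw [mul_left_comm n, h3]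
          ring
      _ ≤ c * (n * (1 + n) ^ (-t)) := by gcongr
      _ ≤ C * n ^ (1 / 2 : ℝ) := h1
  have hlim := tendsto_rpow_atTop (show 0 < 1 / 2 - t by linarith)
  obtain ⟨n, hn1, hn2⟩ := ((Filter.eventually_ge_atTop 1).and
    (hlim.eventually_gt_atTop (C / (c * 2 ^ (-t))))).exists
  exact absurd (hle n hn1) (not_le.mpr hn2)

end AffineWeyl

end

theorem theorem2p3 (p : ℝ) (hp : 2 < p) :
    ∃ σ : AffineWeyl.Symbol,
      AffineWeyl.MemLpSchatten p σ ∧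
      (∀ f g : AffineWeyl.U → ℂ, AffineWeyl.IsTest f → AffineWeyl.IsTest g →
        AffineWeyl.WeylFormExists σ f g) ∧
      ¬ ∃ T : Lp ℂ 2 AffineWeyl.haar →L[ℂ] Lp ℂ 2 AffineWeyl.haar,
        AffineWeyl.IsWeylTransform σ T := by
  have hp0 : 0 < p := by linarith
  have hlt : 1 / p < 1 / 2 := one_div_lt_one_div_of_lt two_pos hp
  -- The lower bound on `t` puts the symbol in `L^p`; the upper bound rules out boundedness. The gap
  -- exists because `p > 2`.
  obtain ⟨t, ht1, ht2⟩ := exists_between hlt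
  have ht0 : 0 ≤ t := (one_div_pos.mpr hp0).le.trans ht1.le
  refine ⟨AffineWeyl.decaySymbol t, ?_, fun f g hf hg => ?_, fun ⟨T, hT⟩ =>
    AffineWeyl.not_isWeylTransform_decaySymbol ht0 ht2 T hT⟩
  · exact AffineWeyl.memLpSchatten_rankOneSymbol (by linarith) (AffineWeyl.measurable_decay t) _
      (fun ε => AffineWeyl.window_mem_domain ε (by positivity))
      (AffineWeyl.lintegral_decay_lt_top hp0 ((div_lt_iff₀ hp0).mp ht1))
  · exact AffineWeyl.weylFormExists_rankOneSymbol (AffineWeyl.measurable_decay t)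
      (AffineWeyl.abs_decay_le_one ht0) hf hg _
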